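/- Let $d\ge 1$ and $\boldsymbol\lambda=(\lambda_1,\dots,\lambda_d)$ with $\lambda_i>-\tfrac12$; write $|\boldsymbol\lambda|=\lambda_1+\cdots+\lambda_d$ and $\mathbf 1=(1,\dots,1)$. Definitions. For $\lambda>-\frac12$ let $w_\lambda(t)=(1-t^2)^{\lambda-1/2}$ on $(-1,1)$ and $c_\lambda=\big(\int_{-1}^1 w_\lambda(t)\,dt\big)^{-1}$. Let $C_n^\lambda$ be the Gegenbauer polynomial: of degree $n$, orthogonal with respect to $w_\lambda$ to all polynomials of lower degree, with $C_n^\lambda(1)=\binom{n+2\lambda-1}{n}$ (with $C_n^0(1)=1$ in the case $\lambda=0$), and let $h_n^\lambda=c_\lambda\int_{-1}^1 C_n^\lambda(t)^2w_\lambda(t)\,dt$. For $\delta>-1$ let $$k_n^\delta(w_\lambda;s,t)=\frac1{\binom{n+\delta}{n}}\sum_{k=0}^n\binom{n-k+\delta}{n-k}\frac{1}{h_k^\lambda}C_k^\lambda(s)C_k^\lambda(t).$$ On $[-1,1]^d$ let $W_{\boldsymbol\lambda}(x)=\prod_{i=1}^d c_{\lambda_i}w_{\lambda_i}(x_i)$.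 Let $\mathcal V_n^d(W_{\boldsymbol\lambda})$ be the space of polynomials of total degree at most $n$ in $d$ variables that are orthogonal, in $\langle f,g\rangle=\int_{[-1,1]^d}fg\,W_{\boldsymbol\lambda}\,dx$, to all polynomials of total degree less than $n$; let $P_n(W_{\boldsymbol\lambda};x,y)=\sum_jP_j^n(x)P_j^n(y)$ be its reproducing kernel, where $(P_j^n)_j$ is any orthonormal basis of $\mathcal V_n^d(W_{\boldsymbol\lambda})$, and let $$K_n^\delta(W_{\boldsymbol\lambda};x,y)=\frac1{\binom{n+\delta}{n}}\sum_{k=0}^n\binom{n-k+\delta}{n-k}P_k(W_{\boldsymbol\lambda};x,y).$$ Let $\mathcal T^d=\{y\in\mathbb R^d: y_i\ge0,\ y_1+\cdots+y_d=1\}$, with $\int_{\mathcal T^d}f(y)\,dy=\int_{\{u\in\mathbb R^{d-1}:\,u_i\ge0,\ |u|\le1\}}f(u_1,\dots,u_{d-1},1-|u|)\,du$ (evaluation at the single point $1$ if $d=1$). Statement. (i) For every $\delta>-1$, every integer $n\ge0$ and every $x\in[-1,1]^d$, the integrals below converge absolutely and $$K_n^{\delta+d-1}(W_{\boldsymbol\lambda};x,\mathbf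 1)=\frac{1}{\binom{n+\delta+d-1}{n}}\sum_{m=0}^{\min\{n,d-1\}}\binom{d-1}{m}\binom{n-m+\delta}{n-m}\,\frac{\Gamma(|\boldsymbol\lambda|+d)}{\prod_{i=1}^d\Gamma(\lambda_i+1)}\int_{\mathcal T^d}k_{n-m}^\delta\big(w_{|\boldsymbol\lambda|+d-1};\langle x,y\rangle,1\big)\prod_{i=1}^dy_i^{\lambda_i}\,dy .$$ (ii) If $\lambda_i\ge0$ for all $i$, then for every $\delta\ge 2(|\boldsymbol\lambda|+d)-1$ and every $n\ge 0$, $K_n^\delta(W_{\boldsymbol\lambda};x,y)\ge0$ for all $x,y\in[-1,1]^d$. (iii) If $|\boldsymbol\lambda|+d-1\ge0$ (which holds automatically when $d\ge2$), then for every $\delta\ge2(|\boldsymbol\lambda|+d)-1$ and every $n\ge 0$, $K_n^{\delta+d-1}(W_{\boldsymbol\lambda};x,\mathbf 1)\ge0$ for all $x\in[-1,1]^d$. -/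

import Mathlib

open MeasureTheory

namespace ProductGegenbauer

noncomputable section

/-! ### Orthogonal polynomials of several variables -/

/-- The bilinear form `⟨f, g⟩_W = ∫_Ω f(x) g(x) W(x) dx` on polynomials in `d` variables. -/
def weightInner {d : ℕ} (Ω : Set (Fin d → ℝ)) (W : (Fin d → ℝ) → ℝ)
    (f g : MvPolynomial (Fin d) ℝ) : ℝ :=
  ∫ x in Ω, MvPolynomial.eval x f * MvPolynomial.eval x g * W x

/-- The space `V_n^d(W)` of orthogonal polynomials of degree `n`: the polynomials of total degree
at most `n` that are orthogonal to every polynomial of total degree less than `n`. -/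
def orthogonalPolynomials {d : ℕ} (Ω : Set (Fin d → ℝ)) (W : (Fin d → ℝ) → ℝ) (n : ℕ) :
    Set (MvPolynomial (Fin d) ℝ) :=
  {P | P.totalDegree ≤ n ∧
    ∀ Q : MvPolynomial (Fin d) ℝ, Q.totalDegree < n → weightInner Ω W P Q = 0}

/-- `P` is a (finite) orthonormal basis of `V_n^d(W)`. -/
structure IsOrthonormalBasisOf {d : ℕ} (Ω : Set (Fin d → ℝ)) (W : (Fin d → ℝ) → ℝ) (n : ℕ)
    {r : ℕ} (P : Fin r → MvPolynomial (Fin d) ℝ) : Prop where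
  mem : ∀ j, P j ∈ orthogonalPolynomials Ω W n
  orthonormal : ∀ j k, weightInner Ω W (P j) (P k) = if j = k then 1 else 0
  span : ∀ Q ∈ orthogonalPolynomials Ω W n, Q ∈ Submodule.span ℝ (Set.range P)

/-- `K` is the kernel `(x, y) ↦ ∑_j P_j(x) P_j(y)` of some orthonormal basis `(P_j)` of
`V_n^d(W)`. -/
def IsReproducingKernel {d : ℕ} (Ω : Set (Fin d → ℝ)) (W : (Fin d → ℝ) → ℝ) (n : ℕ)
    (K : (Fin d → ℝ) → (Fin d → ℝ) → ℝ) : Prop :=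
  ∃ (r : ℕ) (P : Fin r → MvPolynomial (Fin d) ℝ), IsOrthonormalBasisOf Ω W n P ∧
    ∀ x y, K x y = ∑ j, MvPolynomial.eval x (P j) * MvPolynomial.eval y (P j)

/-- The reproducing kernel `P_n(W; x, y)` of `V_n^d(W)`. As usual it is the same for every choice
of the orthonormal basis. -/
def reproducingKernel {d : ℕ} (Ω : Set (Fin d → ℝ)) (W : (Fin d → ℝ) → ℝ) (n : ℕ) :
    (Fin d → ℝ) → (Fin d → ℝ) → ℝ :=
  Classical.epsilon (IsReproducingKernel Ω W n)

/-- The Cesàro `(C, δ)` kernel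
`K_n^δ(W; x, y) = binom(n+δ, n)⁻¹ ∑_{k=0}^n binom(n-k+δ, n-k) P_k(W; x, y)`. -/
def cesaroKernel {d : ℕ} (Ω : Set (Fin d → ℝ)) (W : (Fin d → ℝ) → ℝ) (δ : ℝ) (n : ℕ)
    (x y : Fin d → ℝ) : ℝ :=
  1 / Ring.choose ((n : ℝ) + δ) n *
    ∑ k ∈ Finset.range (n + 1),
      Ring.choose (((n - k : ℕ) : ℝ) + δ) (n - k) * reproducingKernel Ω W k x y

/-! ### Gegenbauer polynomials in one variable -/

/-- The Gegenbauer weight `w_lam(t) = (1 - t^2)^(lam - 1/2)` on `(-1, 1)`. -/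
def gegenbauerWeight (lam t : ℝ) : ℝ := (1 - t ^ 2) ^ (lam - 1 / 2)

/-- The normalization constant `c_lam`, for which `c_lam ∫_{-1}^1 w_lam(t) dt = 1`. -/
def gegenbauerConst (lam : ℝ) : ℝ := (∫ t in (-1 : ℝ)..1, gegenbauerWeight lam t)⁻¹

/-- `C` is the Gegenbauer polynomial `C_n^lam`: it has degree `n`, is orthogonal with respect to
`w_lam` to all polynomials of lower degree, and `C(1) = binom(n + 2 lam - 1, n)`. Only for
`lam = 0`, where this binomial coefficient vanishes for every `n ≥ 1`, the normalization is
replaced by `C(1) = 1` (which gives the Chebyshev polynomial of the first kind). -/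
structure IsGegenbauer (lam : ℝ) (n : ℕ) (C : Polynomial ℝ) : Prop where
  degree_eq : C.degree = n
  orthogonal : ∀ Q : Polynomial ℝ, Q.degree < n →
    ∫ t in (-1 : ℝ)..1, C.eval t * Q.eval t * gegenbauerWeight lam t = 0
  eval_one : C.eval 1 = if lam = 0 then 1 else Ring.choose ((n : ℝ) + 2 * lam - 1) n

/-- The Gegenbauer polynomial `C_n^lam`, for `lam > -1/2`. -/
def gegenbauerC (lam : ℝ) (n : ℕ) : Polynomial ℝ := Classical.epsilon (IsGegenbauer lam n)

/-- The squared norm `h_n^lam = c_lam ∫_{-1}^1 C_n^lam(t)^2 w_lam(t) dt`. -/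
def gegenbauerNormSq (lam : ℝ) (n : ℕ) : ℝ :=
  gegenbauerConst lam *
    ∫ t in (-1 : ℝ)..1, (gegenbauerC lam n).eval t ^ 2 * gegenbauerWeight lam t

/-- The kernel of the `(C, δ)` means of the Gegenbauer polynomials, `k_n^δ(w_lam; s, t) =
binom(n+δ, n)⁻¹ ∑_{k=0}^n binom(n-k+δ, n-k) (h_k^lam)⁻¹ C_k^lam(s) C_k^lam(t)`. -/
def gegenbauerCesaroKernel (lam δ : ℝ) (n : ℕ) (s t : ℝ) : ℝ :=
  1 / Ring.choose ((n : ℝ) + δ) n *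
    ∑ k ∈ Finset.range (n + 1),
      Ring.choose (((n - k : ℕ) : ℝ) + δ) (n - k) *
        (1 / gegenbauerNormSq lam k * (gegenbauerC lam k).eval s * (gegenbauerC lam k).eval t)

/-! ### Product weights on the cube and the simplex -/

/-- The cube `[-1, 1]^d`. -/
def cube (d : ℕ) : Set (Fin d → ℝ) := {x | ∀ i, x i ∈ Set.Icc (-1 : ℝ) 1}

/-- The normalized product Gegenbauer weight `W_lam(x) = ∏_i c_{lam_i} w_{lam_i}(x_i)`. -/
def productWeight {d : ℕ} (lam : Fin d → ℝ) (x : Fin d → ℝ) : ℝ :=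
  (∏ i, gegenbauerConst (lam i)) * ∏ i, gegenbauerWeight (lam i) (x i)

/-- The measure `dy` on the simplex `{y ∈ ℝ^d : y_i ≥ 0, ∑ y_i = 1}` in homogeneous coordinates:
Lebesgue measure of `{u ∈ ℝ^(d-1) : u_i ≥ 0, ∑ u_i ≤ 1}`, transported by
`u ↦ (u_1, …, u_{d-1}, 1 - ∑ u_i)`. -/
def simplexMeasure : (d : ℕ) → Measure (Fin d → ℝ)
  | 0 => 0
  | k + 1 =>
    Measure.map (fun u : Fin k → ℝ => (Fin.snoc u (1 - ∑ i, u i) : Fin (k + 1) → ℝ))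
      (volume.restrict {u : Fin k → ℝ | (∀ i, 0 ≤ u i) ∧ ∑ i, u i ≤ 1})

/-- The constant `σ_a = Γ(|a|) / ∏_i Γ(a_i)`. -/
def sigmaConst {d : ℕ} (a : Fin d → ℝ) : ℝ :=
  Real.Gamma (∑ i, a i) / ∏ i, Real.Gamma (a i)

end

end ProductGegenbauer

open ProductGegenbauer

/-!
Everything is translated into formal power series in one variable `X`. For a real number `a` put
`G_ν(a) = (1 - 2 a X + X²)^(-ν)` (`gegenbauerSeries`). The series `(1 - X²) G_(lam+1)(s)` generates
the reproducing kernels `Z_n(s)` at the point `1` of the spaces of orthogonal polynomials of degree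
`n` for the normalized Gegenbauer weight (`zonal`). This is proved from differential equations: the
partial sums of the `Z_n` satisfy a Jacobi equation, so that they are orthogonal for the weight
multiplied by `1 - x`, and this makes them reproduce the value at `1`
(`gegenbauerMean_zonalSum_mul`). The polynomials `C_n^lam` are multiples of `Z_n`, and
`C_n^lam(s) C_n^lam(t) / h_n^lam = Z_n(s) Z_n(t) / Z_n(1)`, whatever the normalization of `C_n^lam`
(`zonalKernel_eq`). The products of the `Z_n` in the separate variables are an orthogonal basis for
the product weight, so the kernels `P_n(W; x, y)` are generated by the product over `i` of the
one-variable series (`isReproducingKernel_productWeight`), and forming the Cesàro kernel of order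
`δ` is multiplication by `(1 - X)^(-δ-1)` (`cesaroKernel_eq`, `gegenbauerCesaroKernel_eq`).

With `y = (1, …, 1)` the generating function of `K_n^(δ+d-1)` is therefore
`(1 - X)^(-δ-d) (1 - X²)^d ∏ G_(lam_i+1)(x_i)
  = (1 + X)^(d-1) (1 - X)^(-δ-1) (1 - X²) ∏ G_(lam_i+1)(x_i)`.
The Liouville formula (`coeff_prod_gegenbauerSeries_eq_integral`) expresses the product of the
`G_(lam_i+1)(x_i)` as the average of `G_(|lam|+d)(⟨x, y⟩)` over the Dirichlet distribution of `y`: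
since `1 - 2 ⟨x, y⟩ X + X²` is an affine function of `y` on the simplex, both sides can be expanded
by the binomial and multinomial theorems and compared through the moments of the Dirichlet
distribution (`lintegral_dirichlet`). What remains is the generating function of the one-variable
kernels of index `|lam| + d - 1` multiplied by `(1 + X)^(d-1)`, whose coefficients give the sum
over `m`.

Positivity rests on Kogbetliantz' theorem that `(1 - X)^(-2μ-2) (1 - X²) G_(μ+1)(s)` has
nonnegative coefficients for `μ ≥ 0` and `|s| ≤ 1` (`coeffNonneg_kogbetliantz`). This series is
the product of Fejér's series, the case `μ = 0`, and of `((1 - X)² (1 - 2 s X + X²))^(-μ)`, whose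
logarithmic derivative has the coefficients `2 μ (1 + T_(n+1)(s)) ≥ 0`. The product formula
(`zonalKernel_eq_translate`, where `Λ_t` denotes the mean over `t`),
`Z_n(x) Z_n(y) / Z_n(1) = Λ_t Z_n(x y + √(1 - x²) √(1 - y²) t)`,
extends the theorem to two arbitrary points of `[-1, 1]`, and multiplying such series over `i` gives
the positivity for nonnegative indices because `(1 - X)^(-2(|lam|+d)) = ∏ (1 - X)^(-2 lam_i-2)`.
Positivity at the corner `(1, …, 1)` is read off from the integral formula.
-/

section

open Finset

/-! ### The power series `(1 - X) ^ (-ν)` and `(1 - 2 a X + X ^ 2) ^ (-ν)` -/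

namespace PowerSeries

/-- A formal power series solution of the linear equation `p f' = q f` with `p(0) = 1` vanishes
as soon as its constant coefficient does. -/
lemma eq_zero_of_mul_derivative_eq {A : Type*} [CommRing A] [IsAddTorsionFree A]
    {p q f : A⟦X⟧} (hp : constantCoeff p = 1) (h : p * derivative A f = q * f)
    (h0 : constantCoeff f = 0) : f = 0 := by
  suffices H : ∀ n, ∀ m ≤ n, coeff m f = 0 from ext fun n => by simpa using H n n le_rfl
  intro n
  induction n with
  | zero => intro m hm; obtain rfl : m = 0 := by omega
            simpa using h0
  | succ n ih =>
    intro m hm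
    rcases Nat.lt_or_ge m (n + 1) with h1 | h1
    · exact ih m (by omega)
    obtain rfl : m = n + 1 := by omega
    have h2 := congrArg (coeff n) h
    rw [coeff_mul, coeff_mul] at h2
    have hr : ∑ x ∈ antidiagonal n, coeff x.1 q * coeff x.2 f = 0 :=
      sum_eq_zero fun x hx => by
        rw [ih x.2 (by have := mem_antidiagonal.1 hx; omega), mul_zero]
    rw [hr, sum_eq_single (0, n)] at h2
    · rw [coeff_zero_eq_constantCoeff_apply, hp, one_mul, coeff_derivative] at h2
      have h3 : (n + 1) • coeff (n + 1) f = 0 := by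
        rw [nsmul_eq_mul, mul_comm]; exact_mod_cast h2
      exact (smul_eq_zero.1 h3).resolve_left (by omega)
    · rintro ⟨i, j⟩ hx hne
      have := mem_antidiagonal.1 hx
      simp only at this
      have hj : j < n := by
        rcases Nat.eq_zero_or_pos i with h | h
        · subst h; exact absurd (by simpa using this) (by simpa using hne)
        · omega
      rw [coeff_derivative, ih (j + 1) (by omega), zero_mul, mul_zero]
    · intro hx; simp at hx

section

variable (A : Type*) [CommRing A] [Algebra ℝ A]

/-- The series `(1 - X) ^ (-ν)`, with coefficients in a real algebra. -/
noncomputable def negBinomial (ν : ℝ) : A⟦X⟧ := rescale (-1) (binomialSeries A (-ν))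

lemma coeff_negBinomial (ν : ℝ) (n : ℕ) :
    coeff n (negBinomial A ν) = algebraMap ℝ A (Ring.choose (ν + n - 1) n) := by
  rw [negBinomial, coeff_rescale, binomialSeries_coeff, Ring.choose_neg,
    Algebra.algebraMap_eq_smul_one]
  rcases Nat.even_or_odd n with h | h <;>
  simp [h.neg_one_pow, Int.negOnePow_even _ , Int.negOnePow_odd, h, Units.smul_def]

@[simp]
lemma constantCoeff_negBinomial (ν : ℝ) : constantCoeff (negBinomial A ν) = 1 := by
  rw [← coeff_zero_eq_constantCoeff_apply, coeff_negBinomial]; simp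

lemma negBinomial_add (ν μ : ℝ) :
    negBinomial A (ν + μ) = negBinomial A ν * negBinomial A μ := by
  rw [negBinomial, neg_add, binomialSeries_add, map_mul]; rfl

@[simp]
lemma negBinomial_zero : negBinomial A 0 = 1 := by simp [negBinomial]

lemma negBinomial_neg_natCast (n : ℕ) : negBinomial A (-n) = (1 - X) ^ n := by
  rw [negBinomial, neg_neg, binomialSeries_nat]
  simp [rescale_X, sub_eq_add_neg]

lemma succ_mul_choose_add (ν : ℝ) (n : ℕ) :
    ((n : ℝ) + 1) * Ring.choose (ν + (n + 1 : ℕ) - 1) (n + 1) =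
      (ν + n) * Ring.choose (ν + n - 1) n := by
  have h := Ring.choose_smul_choose (ν + n) (n := n + 1) (k := 1) (by omega)
  simp only [Nat.choose_one_right, Ring.choose_one_right, nsmul_eq_mul, Nat.cast_one,
    Nat.add_sub_cancel, Nat.cast_add] at h
  rw [← h]
  push_cast
  ring_nf

lemma choose_add_pos {ν : ℝ} (hν : 0 < ν) (n : ℕ) : 0 < Ring.choose (ν + n - 1) n := by
  induction n with
  | zero => simp
  | succ n ih =>
    have h := succ_mul_choose_add ν n
    have : 0 < (ν + n) * Ring.choose (ν + n - 1) n := by positivity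
    rw [← h] at this
    exact (pos_iff_pos_of_mul_pos this).1 (by positivity)

lemma one_sub_X_mul_derivative_negBinomial (ν : ℝ) :
    (1 - X) * derivative A (negBinomial A ν) =
      algebraMap ℝ A⟦X⟧ ν * negBinomial A ν := by
  ext n
  have h := congrArg (algebraMap ℝ A) (succ_mul_choose_add ν n)
  rw [PowerSeries.algebraMap_apply, coeff_C_mul, sub_mul, one_mul, map_sub, coeff_derivative,
    coeff_negBinomial, coeff_negBinomial]
  simp only [map_mul, map_add, map_natCast, map_one] at h
  cases n with
  | zero =>
    rw [coeff_zero_X_mul]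
    linear_combination h
  | succ n =>
    rw [coeff_succ_X_mul, coeff_derivative, coeff_negBinomial]
    push_cast at h ⊢
    linear_combination h

lemma map_negBinomial {B : Type*} [CommRing B] [Algebra ℝ B] (f : A →ₐ[ℝ] B) (ν : ℝ) :
    map (f : A →+* B) (negBinomial A ν) = negBinomial B ν := by
  ext n; simp [coeff_negBinomial]

end

section

variable {A B : Type*} [CommRing A] [Algebra ℝ A] [CommRing B] [Algebra ℝ B]

/-- The series `(1 - 2 a X + X ^ 2) ^ (-ν)`, whose coefficients are the Gegenbauer polynomials
`C_n^ν` evaluated at `a`. It is obtained by substituting `X (2 a - X)` into `(1 - X) ^ (-ν)`. -/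
noncomputable def gegenbauerSeries (ν : ℝ) (a : A) : A⟦X⟧ :=
  (negBinomial A ν).subst (X * (2 * C a - X) : A⟦X⟧)

lemma hasSubst_quadratic {A : Type*} [CommRing A] (a : A) : HasSubst (X * (2 * C a - X) : A⟦X⟧) :=
  HasSubst.of_constantCoeff_zero' (by simp)

@[simp]
lemma constantCoeff_gegenbauerSeries (ν : ℝ) (a : A) :
    constantCoeff (gegenbauerSeries ν a) = 1 := by
  have h : gegenbauerSeries ν a - 1 =
      ((negBinomial A ν) - 1).subst (X * (2 * C a - X) : A⟦X⟧) := by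
    rw [← coe_substAlgHom (hasSubst_quadratic a), map_sub, map_one,
      coe_substAlgHom (hasSubst_quadratic a)]
    rfl
  have h2 := constantCoeff_subst_eq_zero (a := (X * (2 * C a - X) : A⟦X⟧)) (by
    change constantCoeff (X * (2 * C a - X) : A⟦X⟧) = 0
    simp) (negBinomial A ν - 1) (by simp)
  rw [← h] at h2
  have h3 : constantCoeff (gegenbauerSeries ν a - 1) = 0 := h2
  simpa [sub_eq_zero] using h3

lemma gegenbauerSeries_add (ν μ : ℝ) (a : A) :
    gegenbauerSeries (ν + μ) a = gegenbauerSeries ν a * gegenbauerSeries μ a := by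
  rw [gegenbauerSeries, negBinomial_add, subst_mul (hasSubst_quadratic a)]; rfl

lemma derivative_gegenbauerSeries (ν : ℝ) (a : A) :
    (1 - 2 * C a * X + X ^ 2) * derivative A (gegenbauerSeries ν a) =
      2 * algebraMap ℝ A⟦X⟧ ν * (C a - X) * gegenbauerSeries ν a := by
  have h := congrArg (substAlgHom (R := A) (hasSubst_quadratic a))
    (one_sub_X_mul_derivative_negBinomial A ν)
  simp only [map_mul, map_sub, map_one, substAlgHom_X] at h
  rw [IsScalarTower.algebraMap_apply ℝ A A⟦X⟧, AlgHom.commutes,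
    ← IsScalarTower.algebraMap_apply ℝ A A⟦X⟧, coe_substAlgHom] at h
  rw [gegenbauerSeries, derivative_subst (hasSubst_quadratic a)]
  have d2 : derivative A (2 : A⟦X⟧) = 0 := by simpa using (derivative A).map_natCast 2
  simp only [Derivation.leibniz, map_sub, derivative_X, derivative_C, smul_eq_mul, d2]
  linear_combination 2 * (C a - X) * h

lemma gegenbauerSeries_one_mul (a : A) :
    gegenbauerSeries 1 a * (1 - 2 * C a * X + X ^ 2) = 1 := by
  have h : negBinomial A 1 * (1 - X) = 1 := by
    have := negBinomial_neg_natCast A 1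
    rw [pow_one] at this
    rw [← this, ← negBinomial_add]; simp
  have h := congrArg (substAlgHom (R := A) (hasSubst_quadratic a)) h
  simp only [map_mul, map_sub, map_one, substAlgHom_X] at h
  rw [coe_substAlgHom] at h
  rw [← coe_substAlgHom (hasSubst_quadratic a)] at h
  rw [gegenbauerSeries, ← coe_substAlgHom (hasSubst_quadratic a)]
  linear_combination h

lemma map_gegenbauerSeries (f : A →ₐ[ℝ] B) (ν : ℝ) (a : A) :
    map (f : A →+* B) (gegenbauerSeries ν a) = gegenbauerSeries ν (f a) := by
  have := map_subst (hasSubst_quadratic a) (h := (f : A →+* B)) (negBinomial A ν)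
  refine this.trans ?_
  rw [map_negBinomial]
  change subst (map (f : A →+* B) (X * (2 * C a - X))) _ = _
  have h2 : map (f : A →+* B) 2 = 2 := map_ofNat _ 2
  simp [gegenbauerSeries, h2]

/-- `1 - 2 X + X ^ 2 = (1 - X) ^ 2`. -/
lemma gegenbauerSeries_one_right (ν : ℝ) :
    gegenbauerSeries ν (1 : ℝ) = negBinomial ℝ (2 * ν) := by
  rw [← sub_eq_zero]
  have h1 := derivative_gegenbauerSeries ν (1 : ℝ)
  have h2 := one_sub_X_mul_derivative_negBinomial ℝ (2 * ν)
  refine eq_zero_of_mul_derivative_eq (p := (1 - X) ^ 2)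
    (q := 2 * algebraMap ℝ ℝ⟦X⟧ ν * (1 - X)) (by simp) ?_ (by simp)
  simp only [map_mul, map_one, map_ofNat, map_sub] at h1 h2 ⊢
  linear_combination h1 - (1 - X) * h2

end

end PowerSeries

/-! ### Differential equations for the generating series -/

namespace PowerSeries

/-- Coefficientwise differentiation of a power series whose coefficients are polynomials; together
with the derivation `d⁄dX` it makes partial differential equations for generating functions
available. -/
noncomputable def coeffDerivative :
    Derivation ℝ (Polynomial ℝ)⟦X⟧ (Polynomial ℝ)⟦X⟧ :=
  Derivation.mk'
    { toFun := fun f => mk fun n => Polynomial.derivative (coeff n f)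
      map_add' := fun f g => by ext n : 1; simp
      map_smul' := fun c f => by
        ext n : 1
        simp only [coeff_mk, RingHom.id_apply, coeff_smul]
        simp }
    fun f g => by
      ext n : 1
      simp only [LinearMap.coe_mk, AddHom.coe_mk, coeff_mk, smul_eq_mul, map_add, coeff_mul,
        Polynomial.derivative_sum, Polynomial.derivative_mul, sum_add_distrib]
      rw [add_comm]
      congr 1
      rw [← Finset.Nat.sum_antidiagonal_swap]
      exact sum_congr rfl fun x _ => by simp [mul_comm]

@[simp]
lemma coeff_coeffDerivative (f : (Polynomial ℝ)⟦X⟧) (n : ℕ) :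
    coeff n (coeffDerivative f) = Polynomial.derivative (coeff n f) := by
  simp [coeffDerivative, Derivation.mk']

lemma coeffDerivative_C (p : Polynomial ℝ) :
    coeffDerivative (C p) = C (Polynomial.derivative p) := by
  ext n : 1
  simp only [coeff_coeffDerivative, coeff_C]
  split_ifs <;> simp

lemma coeffDerivative_X : coeffDerivative (X : (Polynomial ℝ)⟦X⟧) = 0 := by
  ext n : 1
  simp only [coeff_coeffDerivative, coeff_X]
  split_ifs <;> simp

lemma coeffDerivative_derivative (f : (Polynomial ℝ)⟦X⟧) :
    coeffDerivative (derivative (Polynomial ℝ) f) =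
      derivative (Polynomial ℝ) (coeffDerivative f) := by
  ext n : 1
  simp [coeff_derivative, Polynomial.derivative_mul]

lemma derivative_two {A : Type*} [CommRing A] :
    derivative A (2 : A⟦X⟧) = 0 := by
  simpa using (derivative A).map_natCast 2

lemma coeffDerivative_two : coeffDerivative (2 : (Polynomial ℝ)⟦X⟧) = 0 := by
  simpa using coeffDerivative.map_natCast 2

lemma derivative_algebraMap {A : Type*} [CommRing A] [Algebra ℝ A] (c : ℝ) :
    derivative A (algebraMap ℝ A⟦X⟧ c) = 0 := by
  rw [IsScalarTower.algebraMap_apply ℝ A A⟦X⟧, Derivation.map_algebraMap]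

lemma coeffDerivative_gegenbauerSeries (ν : ℝ) :
    (1 - 2 * C (Polynomial.X : Polynomial ℝ) * X + X ^ 2) *
        coeffDerivative (gegenbauerSeries ν Polynomial.X) =
      2 * algebraMap ℝ _ ν * X * gegenbauerSeries ν Polynomial.X := by
  set u := gegenbauerSeries ν (Polynomial.X : Polynomial ℝ) with hu
  have e := derivative_gegenbauerSeries ν (Polynomial.X : Polynomial ℝ)
  rw [← hu] at e
  have ex := congrArg coeffDerivative e
  rw [← sub_eq_zero]
  refine eq_zero_of_mul_derivative_eq
    (p := 1 - 2 * C (Polynomial.X : Polynomial ℝ) * X + X ^ 2)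
    (q := (2 * algebraMap ℝ _ ν - 2) * (C Polynomial.X - X)) (by simp) ?_ ?_
  · simp only [Derivation.leibniz, map_sub, map_add, derivative_X, derivative_C, smul_eq_mul,
      derivative_two, coeffDerivative_C, coeffDerivative_X, coeffDerivative_two,
      coeffDerivative_derivative, derivative_algebraMap, Derivation.map_algebraMap, pow_two,
      Polynomial.derivative_X, map_one, Derivation.map_one_eq_zero] at ex ⊢
    linear_combination (1 - 2 * C (Polynomial.X : Polynomial ℝ) * X + X ^ 2) * ex -
      (2 * algebraMap ℝ _ ν - 2) * X * e
  · rw [← coeff_zero_eq_constantCoeff_apply, map_sub]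
    have h0 : coeff 0 u = 1 := by rw [coeff_zero_eq_constantCoeff_apply, hu]; simp
    have h1 : coeff 0 (coeffDerivative u) = 0 := by simp [h0]
    rw [coeff_zero_eq_constantCoeff_apply] at h1
    simp [h1]

section

variable (ν : ℝ)

lemma coeffDerivative_coeffDerivative_gegenbauerSeries :
    (1 - 2 * C (Polynomial.X : Polynomial ℝ) * X + X ^ 2) ^ 2 *
        coeffDerivative (coeffDerivative (gegenbauerSeries ν Polynomial.X)) =
      (2 * algebraMap ℝ _ ν + 2) * (2 * algebraMap ℝ _ ν) * X ^ 2 *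
        gegenbauerSeries ν Polynomial.X := by
  have e := coeffDerivative_gegenbauerSeries ν
  set u := gegenbauerSeries ν (Polynomial.X : Polynomial ℝ) with hu
  have ex := congrArg coeffDerivative e
  simp only [Derivation.leibniz, map_sub, map_add, smul_eq_mul,
      coeffDerivative_C, coeffDerivative_X, coeffDerivative_two,
      Derivation.map_algebraMap, pow_two,
      Polynomial.derivative_X, map_one, Derivation.map_one_eq_zero] at ex
  linear_combination (1 - 2 * C (Polynomial.X : Polynomial ℝ) * X + X ^ 2) * ex +
    (2 * algebraMap ℝ _ ν + 2) * X * e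

lemma derivative_derivative_gegenbauerSeries :
    (1 - 2 * C (Polynomial.X : Polynomial ℝ) * X + X ^ 2) ^ 2 *
        derivative _ (derivative _ (gegenbauerSeries ν Polynomial.X)) =
      ((2 * algebraMap ℝ _ ν + 2) * (2 * algebraMap ℝ _ ν) * (C Polynomial.X - X) ^ 2 -
        2 * algebraMap ℝ _ ν * (1 - 2 * C (Polynomial.X : Polynomial ℝ) * X + X ^ 2)) *
        gegenbauerSeries ν Polynomial.X := by
  have e := derivative_gegenbauerSeries ν (Polynomial.X : Polynomial ℝ)
  set u := gegenbauerSeries ν (Polynomial.X : Polynomial ℝ) with hu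
  have ex := congrArg (derivative (Polynomial ℝ)) e
  simp only [Derivation.leibniz, map_sub, map_add, derivative_X, derivative_C, smul_eq_mul,
      derivative_two, derivative_algebraMap, pow_two, Derivation.map_one_eq_zero] at ex
  linear_combination (1 - 2 * C (Polynomial.X : Polynomial ℝ) * X + X ^ 2) * ex +
    (2 * algebraMap ℝ _ ν + 2) * (C Polynomial.X - X) * e

end

/-- The coefficients of `(1 - X ^ 2) (1 - 2 x X + X ^ 2) ^ (-lam - 1)`, as polynomials in `x`.
The `n`-th one is the reproducing kernel at the point `1` of the space of orthogonal polynomials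
of degree `n` for the normalized Gegenbauer weight, and a multiple of `C_n^lam`. -/
noncomputable def zonal (lam : ℝ) (n : ℕ) : Polynomial ℝ :=
  coeff n ((1 - X ^ 2) * gegenbauerSeries (lam + 1) (Polynomial.X : Polynomial ℝ))

/-- The coefficients of `(1 + X) (1 - 2 x X + X ^ 2) ^ (-lam - 1)`, which are the partial sums of
the polynomials `zonal lam n`. -/
noncomputable def zonalSum (lam : ℝ) (n : ℕ) : Polynomial ℝ :=
  coeff n ((1 + X) * gegenbauerSeries (lam + 1) (Polynomial.X : Polynomial ℝ))

lemma one_sub_two_mul_add_sq_ne_zero :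
    (1 - 2 * C (Polynomial.X : Polynomial ℝ) * X + X ^ 2) ≠ 0 := by
  intro h
  have := congrArg constantCoeff h
  simp at this

lemma coeff_X_mul_derivative {A : Type*} [CommRing A] (f : A⟦X⟧) (n : ℕ) :
    coeff n (X * derivative A f) = n * coeff n f := by
  cases n with
  | zero => simp
  | succ n => rw [coeff_succ_X_mul, coeff_derivative]; push_cast; ring

/-- The Gegenbauer differential equation. -/
theorem zonal_ode (lam : ℝ) (n : ℕ) :
    (1 - Polynomial.X ^ 2) * Polynomial.derivative (Polynomial.derivative (zonal lam n)) -
      Polynomial.C (2 * lam + 1) * Polynomial.X *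
        Polynomial.derivative (zonal lam n) =
      -Polynomial.C (n * (n + 2 * lam)) * zonal lam n := by
  have e1 := coeffDerivative_gegenbauerSeries (lam + 1)
  have e2 := derivative_gegenbauerSeries (lam + 1) (Polynomial.X : Polynomial ℝ)
  have e3 := coeffDerivative_coeffDerivative_gegenbauerSeries (lam + 1)
  have e4 := derivative_derivative_gegenbauerSeries (lam + 1)
  set u := gegenbauerSeries (lam + 1) (Polynomial.X : Polynomial ℝ) with hu
  set Q := (1 - 2 * PowerSeries.C (Polynomial.X : Polynomial ℝ) * PowerSeries.X +
    PowerSeries.X ^ 2) with hQ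
  set a := PowerSeries.C (Polynomial.X : Polynomial ℝ) with ha
  set r := (PowerSeries.X : (Polynomial ℝ)⟦X⟧) with hr
  set l := algebraMap ℝ (Polynomial ℝ)⟦X⟧ lam with hl
  have main : PowerSeries.C (1 - Polynomial.X ^ 2) *
      coeffDerivative (coeffDerivative ((1 - r ^ 2) * u)) -
      PowerSeries.C (Polynomial.C (2 * lam + 1) * Polynomial.X) *
        coeffDerivative ((1 - r ^ 2) * u) +
      r * PowerSeries.derivative _ (r * PowerSeries.derivative _ ((1 - r ^ 2) * u)) +
      PowerSeries.C (Polynomial.C (2 * lam)) * (r * PowerSeries.derivative _ ((1 - r ^ 2) * u)) =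
      0 := by
    have hC : ∀ c : ℝ, PowerSeries.C (Polynomial.C c) = algebraMap ℝ (Polynomial ℝ)⟦X⟧ c :=
      fun c => by rw [PowerSeries.algebraMap_apply]; rfl
    refine (mul_eq_zero.1 (?_ : Q ^ 2 * _ = 0)).resolve_left
      (pow_ne_zero 2 one_sub_two_mul_add_sq_ne_zero)
    simp only [Derivation.leibniz, map_sub, map_add, PowerSeries.derivative_X,
      smul_eq_mul, hr, coeffDerivative_X, pow_two, map_one, hC, map_mul,
      Derivation.map_one_eq_zero, map_zero, map_ofNat] at e1 e2 e3 e4 ⊢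
    simp only [← hr, ← ha, ← hl] at e1 e2 e3 e4 ⊢
    simp only [hQ] at e1 e2 e3 e4 ⊢
    linear_combination (1 - a ^ 2) * (1 - r ^ 2) * e3 - (2 * l + 1) * a * (1 - r ^ 2) * Q * e1 +
      r ^ 2 * (1 - r ^ 2) * e4 + (r * (1 - r ^ 2) - 4 * r ^ 3 + 2 * l * r * (1 - r ^ 2)) * Q * e2
  have h := congrArg (PowerSeries.coeff n) main
  simp only [LinearMap.map_add, LinearMap.map_sub, PowerSeries.coeff_C_mul,
    coeff_coeffDerivative, hr, coeff_X_mul_derivative, LinearMap.map_zero] at h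
  rw [zonal]
  have hn : ((n : ℕ) : Polynomial ℝ) = Polynomial.C (n : ℝ) := by simp
  simp only [hn, Polynomial.C_mul, Polynomial.C_add, Polynomial.C_1] at h ⊢
  linear_combination h

/-- The Jacobi differential equation for the weight `(1 - x) (1 - x ^ 2) ^ (lam - 1 / 2)`. -/
theorem zonalSum_ode (lam : ℝ) (n : ℕ) :
    (1 - Polynomial.X ^ 2) * Polynomial.derivative (Polynomial.derivative (zonalSum lam n)) -
      (Polynomial.C (2 * lam + 2) * Polynomial.X + 1) *
        Polynomial.derivative (zonalSum lam n) =
      -Polynomial.C (n * (n + 2 * lam + 1)) * zonalSum lam n := by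
  have e1 := coeffDerivative_gegenbauerSeries (lam + 1)
  have e2 := derivative_gegenbauerSeries (lam + 1) (Polynomial.X : Polynomial ℝ)
  have e3 := coeffDerivative_coeffDerivative_gegenbauerSeries (lam + 1)
  have e4 := derivative_derivative_gegenbauerSeries (lam + 1)
  set u := gegenbauerSeries (lam + 1) (Polynomial.X : Polynomial ℝ) with hu
  set Q := (1 - 2 * PowerSeries.C (Polynomial.X : Polynomial ℝ) * PowerSeries.X +
    PowerSeries.X ^ 2) with hQ
  set a := PowerSeries.C (Polynomial.X : Polynomial ℝ) with ha
  set r := (PowerSeries.X : (Polynomial ℝ)⟦X⟧) with hr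
  set l := algebraMap ℝ (Polynomial ℝ)⟦X⟧ lam with hl
  have main : PowerSeries.C (1 - Polynomial.X ^ 2) *
      coeffDerivative (coeffDerivative ((1 + r) * u)) -
      PowerSeries.C (Polynomial.C (2 * lam + 2) * Polynomial.X + 1) *
        coeffDerivative ((1 + r) * u) +
      r * PowerSeries.derivative _ (r * PowerSeries.derivative _ ((1 + r) * u)) +
      PowerSeries.C (Polynomial.C (2 * lam + 1)) *
        (r * PowerSeries.derivative _ ((1 + r) * u)) =
      0 := by
    have hC : ∀ c : ℝ, PowerSeries.C (Polynomial.C c) = algebraMap ℝ (Polynomial ℝ)⟦X⟧ c :=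
      fun c => by rw [PowerSeries.algebraMap_apply]; rfl
    refine (mul_eq_zero.1 (?_ : Q ^ 2 * _ = 0)).resolve_left
      (pow_ne_zero 2 one_sub_two_mul_add_sq_ne_zero)
    simp only [Derivation.leibniz, map_sub, map_add, PowerSeries.derivative_X,
      smul_eq_mul, hr, coeffDerivative_X, pow_two, map_one, hC, map_mul,
      Derivation.map_one_eq_zero, map_zero, map_ofNat] at e1 e2 e3 e4 ⊢
    simp only [← hr, ← ha, ← hl] at e1 e2 e3 e4 ⊢
    simp only [hQ] at e1 e2 e3 e4 ⊢
    linear_combination (1 - a ^ 2) * (1 + r) * e3 - ((2 * l + 2) * a + 1) * (1 + r) * Q * e1 +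
      r ^ 2 * (1 + r) * e4 + (r * (1 + r) + 2 * r ^ 2 + (2 * l + 1) * r * (1 + r)) * Q * e2
  have h := congrArg (PowerSeries.coeff n) main
  simp only [LinearMap.map_add, LinearMap.map_sub, PowerSeries.coeff_C_mul,
    coeff_coeffDerivative, hr, coeff_X_mul_derivative, LinearMap.map_zero] at h
  rw [zonalSum]
  have hn : ((n : ℕ) : Polynomial ℝ) = Polynomial.C (n : ℝ) := by simp
  simp only [hn, Polynomial.C_mul, Polynomial.C_add, Polynomial.C_1] at h ⊢
  linear_combination h

end PowerSeries

/-! ### Degrees and values of the zonal polynomials -/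

namespace PowerSeries

lemma gegenbauerSeries_recurrence {A : Type*} [CommRing A] [Algebra ℝ A] (ν : ℝ) (a : A) (n : ℕ) :
    ((n : A) + 2) * coeff (n + 2) (gegenbauerSeries ν a) =
      2 * (algebraMap ℝ A ν + (n + 1)) * a * coeff (n + 1) (gegenbauerSeries ν a) -
        (n + 2 * algebraMap ℝ A ν) * coeff n (gegenbauerSeries ν a) := by
  have h := congrArg (coeff (n + 1)) (derivative_gegenbauerSeries ν a)
  have e1 : (1 - 2 * C a * X + X ^ 2) * derivative A (gegenbauerSeries ν a) =
      derivative A (gegenbauerSeries ν a) -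
      C (2 * a) * (X * derivative A (gegenbauerSeries ν a)) +
      X * (X * derivative A (gegenbauerSeries ν a)) := by
    simp only [map_mul, map_ofNat]; ring
  have e2 : 2 * algebraMap ℝ A⟦X⟧ ν * (C a - X) * gegenbauerSeries ν a =
      C (2 * algebraMap ℝ A ν * a) * gegenbauerSeries ν a -
      C (2 * algebraMap ℝ A ν) * (X * gegenbauerSeries ν a) := by
    rw [PowerSeries.algebraMap_apply]; simp only [map_mul, map_ofNat]; ring
  rw [e1, e2, LinearMap.map_add, LinearMap.map_sub, LinearMap.map_sub, coeff_C_mul, coeff_C_mul,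
    coeff_C_mul] at h
  simp only [coeff_succ_X_mul, coeff_X_mul_derivative, coeff_derivative] at h
  push_cast at h
  linear_combination h

lemma coeff_one_gegenbauerSeries {A : Type*} [CommRing A] [Algebra ℝ A] (ν : ℝ) (a : A) :
    coeff 1 (gegenbauerSeries ν a) = 2 * algebraMap ℝ A ν * a := by
  have hd : constantCoeff (derivative A (gegenbauerSeries ν a)) =
      coeff 1 (gegenbauerSeries ν a) := by
    rw [← coeff_zero_eq_constantCoeff_apply, coeff_derivative]; simp
  have h := congrArg constantCoeff (derivative_gegenbauerSeries ν a)
  have h2 : constantCoeff (2 : A⟦X⟧) = 2 := map_ofNat _ 2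
  simpa [hd, h2, PowerSeries.algebraMap_apply] using h

lemma gegenbauerSeries_coeff_degree {ν : ℝ} (hν : 0 < ν) (n : ℕ) :
    (coeff n (gegenbauerSeries ν (Polynomial.X : Polynomial ℝ))).natDegree ≤ n ∧
      0 < (coeff n (gegenbauerSeries ν (Polynomial.X : Polynomial ℝ))).coeff n := by
  induction n using Nat.strong_induction_on with
  | _ n ih =>
  rcases n with _ | _ | n
  · simp
  · rw [zero_add, coeff_one_gegenbauerSeries]
    have : (2 * algebraMap ℝ (Polynomial ℝ) ν * Polynomial.X) =
      Polynomial.C (2 * ν) * Polynomial.X := by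
        rw [Polynomial.C_mul, map_ofNat, Polynomial.algebraMap_eq]
    rw [this]
    refine ⟨(Polynomial.natDegree_C_mul_le _ _).trans Polynomial.natDegree_X_le, by simpa using hν⟩
  · obtain ⟨h1, h1'⟩ := ih (n + 1) (by omega)
    obtain ⟨h0, -⟩ := ih n (by omega)
    have h := gegenbauerSeries_recurrence ν (Polynomial.X : Polynomial ℝ) n
    set u := fun k => coeff k (gegenbauerSeries ν (Polynomial.X : Polynomial ℝ)) with hu
    change (u (n + 2)).natDegree ≤ n + 2 ∧ 0 < (u (n + 2)).coeff (n + 2)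
    change (u (n + 1)).natDegree ≤ n + 1 at h1
    change 0 < (u (n + 1)).coeff (n + 1) at h1'
    change (u n).natDegree ≤ n at h0
    have h' : u (n + 2) = Polynomial.C (2 * (ν + (n + 1)) / (n + 2)) *
        (Polynomial.X * u (n + 1)) - Polynomial.C ((n + 2 * ν) / (n + 2)) * u n := by
      have hn : ((n : ℝ) + 2) ≠ 0 := by positivity
      have hn' : Polynomial.C ((n : ℝ) + 2) ≠ 0 :=
        Polynomial.C_ne_zero.2 hn
      apply mul_left_cancel₀ hn'
      have hh : ((n : Polynomial ℝ) + 2) * u (n + 2) =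
          2 * (Polynomial.C ν + ((n : Polynomial ℝ) + 1)) * Polynomial.X * u (n + 1) -
            ((n : Polynomial ℝ) + 2 * Polynomial.C ν) * u n := h
      rw [mul_sub, ← mul_assoc, ← mul_assoc, ← mul_assoc, ← Polynomial.C_mul, ← Polynomial.C_mul,
        mul_div_cancel₀ _ hn, mul_div_cancel₀ _ hn]
      simp only [Polynomial.C_mul, Polynomial.C_add, Polynomial.C_1, map_natCast,
        map_ofNat Polynomial.C]
      linear_combination hh
    have hXdeg : (Polynomial.X * u (n + 1)).natDegree ≤ n + 2 :=
      Polynomial.natDegree_mul_le.trans (by rw [Polynomial.natDegree_X]; omega)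
    constructor
    · rw [h']
      refine (Polynomial.natDegree_sub_le _ _).trans (max_le ?_ ?_)
      · exact (Polynomial.natDegree_C_mul_le _ _).trans hXdeg
      · exact (Polynomial.natDegree_C_mul_le _ _).trans (by omega)
    · rw [h', Polynomial.coeff_sub, Polynomial.coeff_C_mul, Polynomial.coeff_C_mul,
        Polynomial.coeff_X_mul, Polynomial.coeff_eq_zero_of_natDegree_lt (by omega : _ < n + 2)]
      have : 0 < 2 * (ν + (n + 1)) / ((n : ℝ) + 2) := by positivity
      simpa using mul_pos this h1'

lemma _root_.Polynomial.degree_eq_of_natDegree_le_of_coeff_pos {p : Polynomial ℝ} {n : ℕ}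
    (h : p.natDegree ≤ n) (h' : 0 < p.coeff n) : p.degree = n :=
  le_antisymm (Polynomial.natDegree_le_iff_degree_le.1 h)
    (Polynomial.le_degree_of_ne_zero h'.ne')

lemma degree_zonalSum {lam : ℝ} (h : -1 < lam) (n : ℕ) : (zonalSum lam n).degree = n := by
  have hν : 0 < lam + 1 := by linarith
  obtain ⟨h1, h2⟩ := gegenbauerSeries_coeff_degree hν n
  apply Polynomial.degree_eq_of_natDegree_le_of_coeff_pos
  all_goals rw [zonalSum, add_mul, one_mul, map_add]
  all_goals cases n with
  | zero => simp
  | succ n => ?_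
  · rw [coeff_succ_X_mul]
    exact (Polynomial.natDegree_add_le _ _).trans
      (max_le h1 ((gegenbauerSeries_coeff_degree hν n).1.trans (by omega)))
  · rw [coeff_succ_X_mul, Polynomial.coeff_add, Polynomial.coeff_eq_zero_of_natDegree_lt
      (Nat.lt_succ_of_le (gegenbauerSeries_coeff_degree hν n).1), add_zero]
    exact h2

lemma degree_zonal {lam : ℝ} (h : -1 < lam) (n : ℕ) : (zonal lam n).degree = n := by
  have hν : 0 < lam + 1 := by linarith
  obtain ⟨h1, h2⟩ := gegenbauerSeries_coeff_degree hν n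
  apply Polynomial.degree_eq_of_natDegree_le_of_coeff_pos
  all_goals rw [zonal, sub_mul, one_mul, map_sub, pow_two, mul_assoc]
  all_goals rcases n with _ | _ | n
  any_goals rw [coeff_succ_X_mul]
  any_goals rw [coeff_succ_X_mul]
  any_goals rw [coeff_zero_X_mul, sub_zero]; assumption
  · exact (Polynomial.natDegree_sub_le _ _).trans
      (max_le h1 ((gegenbauerSeries_coeff_degree hν n).1.trans (by omega)))
  · have h3 := (gegenbauerSeries_coeff_degree hν n).1
    rw [Polynomial.coeff_sub, Polynomial.coeff_eq_zero_of_natDegree_lt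
      (h3.trans_lt (by omega) : _ < n + 1 + 1), sub_zero]
    exact h2

lemma eval_coeff (f : (Polynomial ℝ)⟦X⟧) (x : ℝ) (n : ℕ) :
    (coeff n f).eval x = coeff n (map (Polynomial.evalRingHom x) f) := by simp

lemma map_evalRingHom_gegenbauerSeries (ν x : ℝ) :
    map (Polynomial.evalRingHom x) (gegenbauerSeries ν (Polynomial.X : Polynomial ℝ)) =
      gegenbauerSeries ν x := by
  have h := map_gegenbauerSeries (Polynomial.aeval (R := ℝ) x) ν (Polynomial.X : Polynomial ℝ)
  rw [Polynomial.aeval_X] at h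
  rw [← h]
  congr 1

lemma eval_zonal (lam : ℝ) (n : ℕ) (x : ℝ) :
    (zonal lam n).eval x = coeff n ((1 - X ^ 2) * gegenbauerSeries (lam + 1) x) := by
  rw [zonal, eval_coeff, map_mul, map_evalRingHom_gegenbauerSeries]
  simp

@[simp]
lemma zonal_zero (lam : ℝ) : zonal lam 0 = 1 := by simp [zonal]

lemma zonalSum_zero (lam : ℝ) : zonalSum lam 0 = 1 := by simp [zonalSum]

lemma zonalSum_succ (lam : ℝ) (n : ℕ) :
    zonalSum lam (n + 1) = zonalSum lam n + zonal lam (n + 1) := by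
  have h : (1 - X ^ 2) * gegenbauerSeries (lam + 1) (Polynomial.X : Polynomial ℝ) =
      (1 + X) * gegenbauerSeries (lam + 1) (Polynomial.X : Polynomial ℝ) -
      X * ((1 + X) * gegenbauerSeries (lam + 1) (Polynomial.X : Polynomial ℝ)) := by ring
  rw [zonal, h, map_sub, coeff_succ_X_mul]
  simp [zonalSum]

lemma eval_one_zonal_pos {lam : ℝ} (h : -(1 / 2) < lam) (n : ℕ) : 0 < (zonal lam n).eval 1 := by
  have e : (1 - X ^ 2) * gegenbauerSeries (lam + 1) (1 : ℝ) =
      negBinomial ℝ (2 * lam + 1) + X * negBinomial ℝ (2 * lam + 1) := by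
    have h1 := negBinomial_neg_natCast ℝ 1
    have h2 := negBinomial_add ℝ (-(1 : ℕ)) (2 * (lam + 1))
    rw [h1] at h2
    rw [gegenbauerSeries_one_right, show 2 * lam + 1 = -(1 : ℕ) + 2 * (lam + 1) by
      push_cast; ring, h2]
    ring
  have hp : 0 < 2 * lam + 1 := by linarith
  rw [eval_zonal, e, map_add]
  have h1 : ∀ k, 0 < coeff k (negBinomial ℝ (2 * lam + 1)) := fun k => by
    rw [coeff_negBinomial]; exact choose_add_pos hp k
  cases n with
  | zero => simp
  | succ n => rw [coeff_succ_X_mul]; exact add_pos (h1 _) (h1 _)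

end PowerSeries

/-! ### Power series with nonnegative coefficients -/

namespace PowerSeries

/-- All coefficients of the real power series `f` are nonnegative. -/
def CoeffNonneg (f : ℝ⟦X⟧) : Prop := ∀ n, 0 ≤ coeff n f

lemma CoeffNonneg.mul {f g : ℝ⟦X⟧} (hf : CoeffNonneg f) (hg : CoeffNonneg g) :
    CoeffNonneg (f * g) := fun n => by
  rw [coeff_mul]
  exact sum_nonneg fun x _ => mul_nonneg (hf _) (hg _)

lemma CoeffNonneg.one : CoeffNonneg 1 := fun n => by
  rw [coeff_one]; split_ifs <;> norm_num

lemma CoeffNonneg.prod {ι : Type*} (s : Finset ι) {f : ι → ℝ⟦X⟧}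
    (hf : ∀ i ∈ s, CoeffNonneg (f i)) : CoeffNonneg (∏ i ∈ s, f i) :=
  prod_induction f CoeffNonneg (fun _ _ => CoeffNonneg.mul) CoeffNonneg.one hf

lemma CoeffNonneg.one_add_X : CoeffNonneg (1 + X) := fun n => by
  rw [map_add, coeff_one, coeff_X]
  split_ifs <;> norm_num

lemma coeffNonneg_negBinomial {ν : ℝ} (hν : 0 ≤ ν) : CoeffNonneg (negBinomial ℝ ν) := by
  rcases hν.eq_or_lt with rfl | h
  · rw [negBinomial_zero]; exact CoeffNonneg.one
  · exact fun n => by rw [coeff_negBinomial]; exact (choose_add_pos h n).le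

/-- A solution of `f' = q f` with `f(0) ≥ 0` has nonnegative coefficients if `q` does. -/
lemma CoeffNonneg.of_derivative_eq {f q : ℝ⟦X⟧} (hq : CoeffNonneg q)
    (h : derivative ℝ f = q * f) (h0 : 0 ≤ constantCoeff f) : CoeffNonneg f := fun n => by
  induction n using Nat.strong_induction_on with
  | _ n ih =>
  cases n with
  | zero => simpa using h0
  | succ n =>
    have h1 := congrArg (coeff n) h
    rw [coeff_derivative, coeff_mul] at h1
    have h2 : 0 ≤ ∑ p ∈ antidiagonal n, coeff p.1 q * coeff p.2 f :=
      sum_nonneg fun p hp => mul_nonneg (hq _)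
        (ih _ (by have := mem_antidiagonal.1 hp; omega))
    rw [← h1] at h2
    exact nonneg_of_mul_nonneg_left h2 (by positivity)

lemma negBinomial_one_mul : negBinomial ℝ 1 * (1 - X) = 1 := by
  have := negBinomial_neg_natCast ℝ 1
  rw [pow_one] at this
  rw [← this, ← negBinomial_add]; simp

lemma coeff_negBinomial_one (n : ℕ) : coeff n (negBinomial ℝ 1) = 1 := by
  have h := (mk_one_mul_one_sub_eq_one ℝ)
  have : negBinomial ℝ 1 = mk 1 := by
    calc negBinomial ℝ 1 = negBinomial ℝ 1 * (mk 1 * (1 - X)) := by rw [h, mul_one]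
      _ = mk 1 * (negBinomial ℝ 1 * (1 - X)) := by ring
      _ = mk 1 := by rw [negBinomial_one_mul, mul_one]
  rw [this]; simp

/-- The generating function of the Chebyshev polynomials `T_(n+1)`. -/
lemma coeff_chebyshev (x : ℝ) (n : ℕ) :
    coeff n ((C x - X) * gegenbauerSeries 1 x) =
      (Polynomial.Chebyshev.T ℝ (n + 1 : ℕ)).eval x := by
  have key : (mk fun n : ℕ => (Polynomial.Chebyshev.T ℝ (n + 1 : ℕ)).eval x) *
      (1 - 2 * C x * X + X ^ 2) = C x - X := by
    have e : ∀ f : ℝ⟦X⟧, f * (1 - 2 * C x * X + X ^ 2) = f - C (2 * x) * (X * f) + X * (X * f) :=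
      fun f => by simp only [map_mul, map_ofNat]; ring
    rw [e]
    ext n
    rw [LinearMap.map_add, LinearMap.map_sub, coeff_C_mul, LinearMap.map_sub]
    rcases n with _ | _ | n
    · simp
    · simp only [coeff_succ_X_mul, coeff_mk, coeff_C, coeff_X]
      simp [Polynomial.Chebyshev.T_two]; ring
    · simp only [coeff_succ_X_mul, coeff_mk, coeff_C, coeff_X]
      have := Polynomial.Chebyshev.T_add_two ℝ ((n : ℤ) + 1)
      push_cast
      rw [show (n : ℤ) + 1 + 1 + 1 = n + 1 + 2 by ring, this]
      simp
  rw [← key, mul_assoc, mul_comm (_ - _ + _), gegenbauerSeries_one_mul, mul_one, coeff_mk]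

/-- Fejér's theorem: the Cesàro means of order one of the Poisson kernel
`(1 - r ^ 2) / (1 - 2 x r + r ^ 2)` are nonnegative. -/
lemma coeffNonneg_fejer {x : ℝ} (hx : |x| ≤ 1) :
    CoeffNonneg (negBinomial ℝ 2 * ((1 - X ^ 2) * gegenbauerSeries 1 x)) := by
  have h2 : negBinomial ℝ 2 = negBinomial ℝ 1 * negBinomial ℝ 1 := by
    rw [← negBinomial_add]; norm_num
  have e : negBinomial ℝ 2 * ((1 - X ^ 2) * gegenbauerSeries 1 x) =
      (1 + X) * negBinomial ℝ 1 * gegenbauerSeries 1 x := by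
    rw [h2]
    linear_combination (1 + X) * negBinomial ℝ 1 * gegenbauerSeries 1 x * negBinomial_one_mul
  rw [e]
  rcases (abs_le.1 hx).2.eq_or_lt with rfl | hx1
  · rw [gegenbauerSeries_one_right]
    exact (CoeffNonneg.one_add_X.mul (coeffNonneg_negBinomial zero_le_one)).mul
      (coeffNonneg_negBinomial (by norm_num))
  · have key : C (1 - x) * ((1 + X) * negBinomial ℝ 1 * gegenbauerSeries 1 x) =
        negBinomial ℝ 1 - (C x - X) * gegenbauerSeries 1 x := by
      have h1 := negBinomial_one_mul
      have h3 := gegenbauerSeries_one_mul x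
      rw [map_sub, map_one]
      linear_combination negBinomial ℝ 1 * h3 - (C x - X) * gegenbauerSeries 1 x * h1
    intro n
    have hn := congrArg (coeff n) key
    rw [coeff_C_mul, map_sub, coeff_negBinomial_one, coeff_chebyshev] at hn
    have hT := Polynomial.Chebyshev.abs_eval_T_real_le_one (n + 1 : ℕ) hx
    refine nonneg_of_mul_nonneg_right (a := 1 - x) ?_ (by linarith)
    rw [hn]
    linarith [(abs_le.1 hT).2]

/-- The logarithmic derivative of `((1 - X) ^ 2 (1 - 2 x X + X ^ 2)) ^ (-μ)` has the nonnegative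
coefficients `2 μ (1 + T_(n+1) x)`. -/
lemma coeffNonneg_negBinomial_mul_gegenbauerSeries {μ x : ℝ} (hμ : 0 ≤ μ) (hx : |x| ≤ 1) :
    CoeffNonneg (negBinomial ℝ (2 * μ) * gegenbauerSeries μ x) := by
  refine CoeffNonneg.of_derivative_eq
    (q := C (2 * μ) * (negBinomial ℝ 1 + (C x - X) * gegenbauerSeries 1 x)) ?_ ?_ (by simp)
  · intro n
    rw [coeff_C_mul, map_add, coeff_negBinomial_one, coeff_chebyshev]
    have hT := Polynomial.Chebyshev.abs_eval_T_real_le_one (n + 1 : ℕ) hx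
    have := (abs_le.1 hT).1
    exact mul_nonneg (by linarith) (by linarith)
  · have h1 := negBinomial_one_mul
    have h3 := gegenbauerSeries_one_mul x
    have d1 := one_sub_X_mul_derivative_negBinomial ℝ (2 * μ)
    have d3 := derivative_gegenbauerSeries μ x
    rw [PowerSeries.algebraMap_apply, Algebra.algebraMap_self, RingHom.id_apply] at d1 d3
    have e1 : derivative ℝ (negBinomial ℝ (2 * μ)) =
        negBinomial ℝ 1 * (C (2 * μ) * negBinomial ℝ (2 * μ)) := by
      linear_combination negBinomial ℝ 1 * d1 - derivative ℝ (negBinomial ℝ (2 * μ)) * h1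
    have e3 : derivative ℝ (gegenbauerSeries μ x) =
        gegenbauerSeries 1 x * (2 * C μ * (C x - X) * gegenbauerSeries μ x) := by
      linear_combination gegenbauerSeries 1 x * d3 - derivative ℝ (gegenbauerSeries μ x) * h3
    rw [Derivation.leibniz, e1, e3]
    simp only [smul_eq_mul, map_mul, map_ofNat C]
    ring

/-- Kogbetliantz' theorem: the Cesàro means of order `2 μ + 1` of the expansions in Gegenbauer
polynomials of index `μ ≥ 0` are positive, here at the end point `1`. -/
theorem coeffNonneg_kogbetliantz {μ x : ℝ} (hμ : 0 ≤ μ) (hx : |x| ≤ 1) :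
    CoeffNonneg (negBinomial ℝ (2 * μ + 2) * ((1 - X ^ 2) * gegenbauerSeries (μ + 1) x)) := by
  rw [negBinomial_add, gegenbauerSeries_add]
  have := (coeffNonneg_negBinomial_mul_gegenbauerSeries hμ hx).mul (coeffNonneg_fejer hx)
  convert! this using 1
  ring

end PowerSeries

end

open PowerSeries (zonal zonalSum negBinomial gegenbauerSeries CoeffNonneg)

/-! ### The Gegenbauer weight and its orthogonal polynomials -/

/-- Eliminating the leading term of a polynomial of degree at most `n`. -/
lemma Polynomial.degree_sub_C_mul_lt {K : Type*} [Field K] {p q : Polynomial K} {n : ℕ}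
    (hq : q.degree ≤ n) (hp : p.degree = n) :
    (q - Polynomial.C (q.coeff n / p.coeff n) * p).degree < n := by
  have hlc : p.coeff n ≠ 0 := Polynomial.coeff_ne_zero_of_eq_degree hp
  rw [Polynomial.degree_lt_iff_coeff_zero]
  intro m hm
  rw [Polynomial.coeff_sub, Polynomial.coeff_C_mul]
  rcases hm.eq_or_lt with rfl | hm
  · rw [div_mul_cancel₀ _ hlc, sub_self]
  · have hm' : (n : WithBot ℕ) < m := by exact_mod_cast hm
    rw [Polynomial.coeff_eq_zero_of_degree_lt (hq.trans_lt hm'),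
      Polynomial.coeff_eq_zero_of_degree_lt (hp.trans_lt hm'), mul_zero, sub_self]

lemma Polynomial.mem_span_of_degree_lt {K : Type*} [Field K] {P : ℕ → Polynomial K}
    (hP : ∀ j, (P j).degree = j) {n : ℕ} {q : Polynomial K} (hq : q.degree < n) :
    q ∈ Submodule.span K (P '' Set.Iio n) := by
  induction n generalizing q with
  | zero =>
    have : q = 0 := by
      rw [← Polynomial.degree_eq_bot]
      exact Nat.WithBot.lt_zero_iff.1 hq
    rw [this]; exact Submodule.zero_mem _
  | succ n ih =>
    have hq' : q.degree ≤ n := Polynomial.degree_le_iff_coeff_zero _ _ |>.2 fun m hm =>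
      (Polynomial.degree_lt_iff_coeff_zero _ _).1 hq m (by exact_mod_cast hm)
    set c := q.coeff n / (P n).coeff n
    have hlt : (q - c • P n).degree < n := by
      rw [Polynomial.smul_eq_C_mul]
      exact Polynomial.degree_sub_C_mul_lt hq' (hP n)
    have h1 : q - c • P n ∈ Submodule.span K (P '' Set.Iio (n + 1)) :=
      Submodule.span_mono (Set.image_mono (Set.Iio_subset_Iio (Nat.le_succ n))) (ih hlt)
    have h2 : c • P n ∈ Submodule.span K (P '' Set.Iio (n + 1)) :=
      Submodule.smul_mem _ _ (Submodule.subset_span ⟨n, Nat.lt_succ_self n, rfl⟩)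
    simpa using Submodule.add_mem _ h1 h2

/-- A linear functional vanishing on one polynomial of each degree below `n` vanishes on all
polynomials of degree below `n`. -/
lemma Polynomial.linearMap_eq_zero_of_degree_lt {K : Type*} [Field K] {P : ℕ → Polynomial K}
    (hP : ∀ j, (P j).degree = j) {n : ℕ} (φ : Polynomial K →ₗ[K] K) (hφ : ∀ j < n, φ (P j) = 0)
    {q : Polynomial K} (hq : q.degree < n) : φ q = 0 := by
  have := Polynomial.mem_span_of_degree_lt hP hq
  have hle : Submodule.span K (P '' Set.Iio n) ≤ LinearMap.ker φ := by
    rw [Submodule.span_le]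
    rintro _ ⟨j, hj, rfl⟩
    exact hφ j hj
  exact hle this

namespace ProductGegenbauer

lemma intervalIntegrable_gegenbauerWeight {lam : ℝ} (h : -(1 / 2) < lam) :
    IntervalIntegrable (gegenbauerWeight lam) volume (-1) 1 := by
  have h01 : IntervalIntegrable (gegenbauerWeight lam) volume 0 1 := by
    have h1 : IntervalIntegrable (fun t : ℝ => (1 - t) ^ (lam - 1 / 2)) volume 0 1 := by
      have := (intervalIntegral.intervalIntegrable_rpow' (a := 0) (b := 1)
        (r := lam - 1 / 2) (by linarith)).comp_sub_left 1
      simpa using this.symm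
    have h2 : ContinuousOn (fun t : ℝ => (1 + t) ^ (lam - 1 / 2)) (Set.uIcc 0 1) := by
      intro t ht
      rw [Set.uIcc_of_le zero_le_one] at ht
      exact (ContinuousAt.rpow_const (by fun_prop)
        (Or.inl (by linarith [ht.1]))).continuousWithinAt
    refine (h1.mul_continuousOn h2).congr fun t ht => ?_
    rw [Set.uIoc_of_le zero_le_one] at ht
    simp only [gegenbauerWeight]
    rw [← Real.mul_rpow (by linarith [ht.2]) (by linarith [ht.1])]
    ring_nf
  have h10 : IntervalIntegrable (gegenbauerWeight lam) volume (-1) 0 := by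
    have := (IntervalIntegrable.iff_comp_neg).1 h01
    have e : (fun x => gegenbauerWeight lam (-x)) = gegenbauerWeight lam := by
      ext x; simp [gegenbauerWeight]
    rw [e] at this
    simpa using this.symm
  exact h10.trans h01

lemma intervalIntegrable_eval_mul_gegenbauerWeight {lam : ℝ} (h : -(1 / 2) < lam)
    (p : Polynomial ℝ) :
    IntervalIntegrable (fun t => p.eval t * gegenbauerWeight lam t) volume (-1) 1 :=
  (intervalIntegrable_gegenbauerWeight h).continuousOn_mul p.continuous.continuousOn

lemma gegenbauerWeight_pos {lam t : ℝ} (ht : t ∈ Set.Ioo (-1 : ℝ) 1) :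
    0 < gegenbauerWeight lam t :=
  Real.rpow_pos_of_pos (by nlinarith [ht.1, ht.2]) _

lemma gegenbauerWeight_nonneg {lam t : ℝ} (ht : t ∈ Set.Icc (-1 : ℝ) 1) :
    0 ≤ gegenbauerWeight lam t :=
  Real.rpow_nonneg (by nlinarith [ht.1, ht.2]) _

lemma integral_gegenbauerWeight_pos {lam : ℝ} (h : -(1 / 2) < lam) :
    0 < ∫ t in (-1 : ℝ)..1, gegenbauerWeight lam t :=
  intervalIntegral.intervalIntegral_pos_of_pos_on (intervalIntegrable_gegenbauerWeight h)
    (fun _ ht => gegenbauerWeight_pos ht) (by norm_num)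

lemma gegenbauerConst_pos {lam : ℝ} (h : -(1 / 2) < lam) : 0 < gegenbauerConst lam :=
  inv_pos.2 (integral_gegenbauerWeight_pos h)

/-- The mean of a polynomial with respect to the normalized Gegenbauer weight. -/
noncomputable def gegenbauerMean {lam : ℝ} (h : -(1 / 2) < lam) : Polynomial ℝ →ₗ[ℝ] ℝ where
  toFun p := gegenbauerConst lam * ∫ t in (-1 : ℝ)..1, p.eval t * gegenbauerWeight lam t
  map_add' p q := by
    rw [← mul_add, ← intervalIntegral.integral_add
      (intervalIntegrable_eval_mul_gegenbauerWeight h p)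
      (intervalIntegrable_eval_mul_gegenbauerWeight h q)]
    simp only [Polynomial.eval_add, add_mul]
  map_smul' c p := by
    simp only [Polynomial.eval_smul, smul_eq_mul, RingHom.id_apply, mul_assoc,
      intervalIntegral.integral_const_mul]
    ring

section Mean

variable {lam : ℝ} (h : -(1 / 2) < lam)

lemma gegenbauerMean_apply (p : Polynomial ℝ) :
    gegenbauerMean h p =
      gegenbauerConst lam * ∫ t in (-1 : ℝ)..1, p.eval t * gegenbauerWeight lam t := rfl

lemma gegenbauerMean_one : gegenbauerMean h 1 = 1 := by
  simp [gegenbauerMean_apply, gegenbauerConst,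
    inv_mul_cancel₀ (integral_gegenbauerWeight_pos h).ne']

lemma gegenbauerMean_nonneg {p : Polynomial ℝ} (hp : ∀ t ∈ Set.Icc (-1 : ℝ) 1, 0 ≤ p.eval t) :
    0 ≤ gegenbauerMean h p :=
  mul_nonneg (gegenbauerConst_pos h).le (intervalIntegral.integral_nonneg (by norm_num)
    fun t ht => mul_nonneg (hp t ht) (gegenbauerWeight_nonneg ht))

/-- Integration by parts: `((1 - x ^ 2) ^ (lam + 1 / 2) p)'` has mean zero over `[-1, 1]`. -/
lemma gegenbauerMean_derivative (p : Polynomial ℝ) :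
    gegenbauerMean h ((1 - Polynomial.X ^ 2) * Polynomial.derivative p -
      Polynomial.C (2 * lam + 1) * Polynomial.X * p) = 0 := by
  rw [gegenbauerMean_apply, intervalIntegral.integral_eq_sub_of_hasDerivAt_of_le
    (f := fun t => (1 - t ^ 2) ^ (lam + 1 / 2) * p.eval t) (by norm_num)]
  · norm_num
    rw [Real.zero_rpow (by linarith)]
    simp
  · have : ContinuousOn (fun t : ℝ => (1 - t ^ 2) ^ (lam + 1 / 2)) (Set.Icc (-1) 1) :=
      ContinuousOn.rpow_const (by fun_prop) fun _ _ => Or.inr (by linarith)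
    exact this.mul p.continuous.continuousOn
  · intro t ht
    have hpos : 0 < 1 - t ^ 2 := by nlinarith [ht.1, ht.2]
    have h1 : HasDerivAt (fun t : ℝ => 1 - t ^ 2) (-(2 * t)) t := by
      simpa using ((hasDerivAt_id t).pow 2).const_sub 1
    have h2 := (h1.rpow_const (p := lam + 1 / 2) (Or.inl hpos.ne')).mul (p.hasDerivAt t)
    convert! h2 using 1
    have e1 : lam + 1 / 2 - 1 = lam - 1 / 2 := by ring
    have e2 : (1 - t ^ 2) ^ (lam + 1 / 2) = (1 - t ^ 2) ^ (lam - 1 / 2) * (1 - t ^ 2) := by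
      rw [← Real.rpow_add_one hpos.ne']; ring_nf
    rw [e1, e2, gegenbauerWeight]
    simp
    ring
  · exact intervalIntegrable_eval_mul_gegenbauerWeight h _

lemma gegenbauerMean_C_mul (c : ℝ) (p : Polynomial ℝ) :
    gegenbauerMean h (Polynomial.C c * p) = c * gegenbauerMean h p := by
  rw [← Polynomial.smul_eq_C_mul, map_smul, smul_eq_mul]

lemma gegenbauerMean_zonal_succ (n : ℕ) : gegenbauerMean h (zonal lam (n + 1)) = 0 := by
  have h1 := gegenbauerMean_derivative h (Polynomial.derivative (zonal lam (n + 1)))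
  rw [PowerSeries.zonal_ode, neg_mul, map_neg, gegenbauerMean_C_mul, neg_eq_zero] at h1
  refine (mul_eq_zero.1 h1).resolve_left (ne_of_gt ?_)
  push_cast
  have : (0 : ℝ) ≤ n := n.cast_nonneg
  exact mul_pos (by positivity) (by linarith)

lemma gegenbauerMean_zonalSum (n : ℕ) : gegenbauerMean h (zonalSum lam n) = 1 := by
  induction n with
  | zero => rw [PowerSeries.zonalSum_zero, gegenbauerMean_one]
  | succ n ih => rw [PowerSeries.zonalSum_succ, map_add, ih, gegenbauerMean_zonal_succ, add_zero]

/-- The polynomials `zonalSum lam n` are orthogonal for the weight `(1 - x) (1 - x²) ^ (lam - 1/2)`,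
as eigenfunctions of a symmetric operator for different eigenvalues. -/
lemma gegenbauerMean_zonalSum_mul_zonalSum {m n : ℕ} (hmn : m ≠ n) :
    gegenbauerMean h ((1 - Polynomial.X) * zonalSum lam n * zonalSum lam m) = 0 := by
  have e1 := PowerSeries.zonalSum_ode lam n
  have e2 := PowerSeries.zonalSum_ode lam m
  set f := zonalSum lam n
  set g := zonalSum lam m
  have h1 := gegenbauerMean_derivative h ((1 - Polynomial.X) *
    (Polynomial.derivative f * g - f * Polynomial.derivative g))
  have e : (1 - Polynomial.X ^ 2) * Polynomial.derivative ((1 - Polynomial.X) *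
      (Polynomial.derivative f * g - f * Polynomial.derivative g)) -
      Polynomial.C (2 * lam + 1) * Polynomial.X * ((1 - Polynomial.X) *
      (Polynomial.derivative f * g - f * Polynomial.derivative g)) =
      Polynomial.C (((m : ℝ) - n) * (m + n + 2 * lam + 1)) * ((1 - Polynomial.X) * f * g) := by
    simp only [Polynomial.derivative_mul, Polynomial.derivative_sub, Polynomial.derivative_one,
      Polynomial.derivative_X, Polynomial.C_mul, Polynomial.C_add, Polynomial.C_sub,
      Polynomial.C_1, map_ofNat Polynomial.C] at e1 e2 ⊢
    linear_combination (1 - Polynomial.X) * g * e1 - (1 - Polynomial.X) * f * e2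
  rw [e, gegenbauerMean_C_mul] at h1
  refine (mul_eq_zero.1 h1).resolve_left (mul_ne_zero ?_ ?_)
  · rw [sub_ne_zero]; exact_mod_cast hmn
  · have : (1 : ℝ) ≤ m + n := by
      have : 1 ≤ m + n := by omega
      exact_mod_cast this
    linarith

/-- `zonalSum lam n` is the reproducing kernel at the point `1` of the polynomials of degree at
most `n`. -/
lemma gegenbauerMean_zonalSum_mul {n : ℕ} {p : Polynomial ℝ} (hp : p.degree ≤ n) :
    gegenbauerMean h (zonalSum lam n * p) = p.eval 1 := by
  have hq := Polynomial.mul_divByMonic_eq_iff_isRoot (p := p - Polynomial.C (p.eval 1))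
    (a := (1 : ℝ)) |>.2 (by simp)
  set q := (p - Polynomial.C (p.eval 1)) /ₘ (Polynomial.X - Polynomial.C 1) with hqdef
  have hqdeg : q.degree < n := by
    by_cases hq0 : q = 0
    · rw [hq0, Polynomial.degree_zero]; exact WithBot.bot_lt_coe n
    have h2 : ((Polynomial.X - Polynomial.C (1 : ℝ)) * q).degree ≤ (n : WithBot ℕ) := by
      rw [hq]
      exact (Polynomial.degree_sub_le _ _).trans (max_le hp
        (Polynomial.degree_C_le.trans (by exact_mod_cast Nat.zero_le n)))
    rw [Polynomial.degree_mul, Polynomial.degree_X_sub_C, Polynomial.degree_eq_natDegree hq0] at h2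
    rw [Polynomial.degree_eq_natDegree hq0]
    norm_cast at h2 ⊢
    omega
  have h0 : gegenbauerMean h ((1 - Polynomial.X) * zonalSum lam n * q) = 0 :=
    Polynomial.linearMap_eq_zero_of_degree_lt
      (PowerSeries.degree_zonalSum (by linarith : -1 < lam))
      (gegenbauerMean h ∘ₗ LinearMap.mulLeft ℝ ((1 - Polynomial.X) * zonalSum lam n))
      (fun j hj => gegenbauerMean_zonalSum_mul_zonalSum h hj.ne) hqdeg
  have e : zonalSum lam n * p = Polynomial.C (p.eval 1) * zonalSum lam n -
      (1 - Polynomial.X) * zonalSum lam n * q := by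
    rw [Polynomial.C_1] at hq
    linear_combination (-zonalSum lam n) * hq
  rw [e, map_sub, h0, gegenbauerMean_C_mul, gegenbauerMean_zonalSum, mul_one, sub_zero]

lemma gegenbauerMean_zonal_mul_of_degree_lt {n : ℕ} {p : Polynomial ℝ} (hp : p.degree < n) :
    gegenbauerMean h (zonal lam n * p) = 0 := by
  cases n with
  | zero =>
    have : p = 0 := by
      rw [← Polynomial.degree_eq_bot]
      exact Nat.WithBot.lt_zero_iff.1 hp
    simp [this]
  | succ n =>
    have e : zonal lam (n + 1) * p = zonalSum lam (n + 1) * p - zonalSum lam n * p := by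
      rw [PowerSeries.zonalSum_succ]; ring
    have hp' : p.degree ≤ n := Polynomial.degree_le_iff_coeff_zero _ _ |>.2 fun m hm =>
      (Polynomial.degree_lt_iff_coeff_zero _ _).1 hp m (by exact_mod_cast hm)
    rw [e, map_sub, gegenbauerMean_zonalSum_mul h hp.le, gegenbauerMean_zonalSum_mul h hp',
      sub_self]

lemma gegenbauerMean_zonal_mul_zonal (m n : ℕ) :
    gegenbauerMean h (zonal lam m * zonal lam n) =
      if m = n then (zonal lam n).eval 1 else 0 := by
  have hdeg := PowerSeries.degree_zonal (by linarith : -1 < lam)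
  rcases lt_trichotomy m n with hmn | rfl | hmn
  · rw [if_neg hmn.ne, mul_comm]
    exact gegenbauerMean_zonal_mul_of_degree_lt h (by rw [hdeg]; exact_mod_cast hmn)
  · rw [if_pos rfl]
    cases m with
    | zero => simp [gegenbauerMean_one]
    | succ m =>
      have e : zonal lam (m + 1) * zonal lam (m + 1) =
          zonalSum lam (m + 1) * zonal lam (m + 1) - zonal lam (m + 1) * zonalSum lam m := by
        rw [PowerSeries.zonalSum_succ]; ring
      rw [e, map_sub, gegenbauerMean_zonalSum_mul h (hdeg _).le,
        gegenbauerMean_zonal_mul_of_degree_lt h, sub_zero]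
      rw [PowerSeries.degree_zonalSum (by linarith : -1 < lam)]
      exact_mod_cast Nat.lt_succ_self m
  · rw [if_neg hmn.ne']
    exact gegenbauerMean_zonal_mul_of_degree_lt h (by rw [hdeg]; exact_mod_cast hmn)

/-- A polynomial of degree at most `n` orthogonal to all polynomials of lower degree is a multiple
of `zonal lam n`. -/
lemma eq_C_mul_zonal {n : ℕ} {p : Polynomial ℝ} (hp : p.degree ≤ n)
    (horth : ∀ j < n, gegenbauerMean h (p * zonal lam j) = 0) :
    ∃ c : ℝ, p = Polynomial.C c * zonal lam n := by
  have hdeg := PowerSeries.degree_zonal (by linarith : -1 < lam)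
  refine ⟨p.coeff n / (zonal lam n).coeff n, ?_⟩
  set c := p.coeff n / (zonal lam n).coeff n
  set g := p - Polynomial.C c * zonal lam n with hg
  have hlt : g.degree < n := Polynomial.degree_sub_C_mul_lt hp (hdeg n)
  have horth' : ∀ j < n, gegenbauerMean h (g * zonal lam j) = 0 := fun j hj => by
    rw [hg, sub_mul, map_sub, horth j hj, mul_assoc, gegenbauerMean_C_mul,
      gegenbauerMean_zonal_mul_zonal, if_neg hj.ne', mul_zero, sub_zero]
  -- `g` is orthogonal to everything of degree below `n`, in particular to each `zonal lam j`
  -- occurring in its own expansion.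
  suffices hg0 : g = 0 from sub_eq_zero.1 hg0
  by_contra hne
  set k := g.natDegree with hk
  have hkn : k < n := (Polynomial.natDegree_lt_iff_degree_lt hne).2 hlt
  have hsub := Polynomial.degree_sub_C_mul_lt (Polynomial.degree_le_natDegree (p := g)) (hdeg k)
  have h3 := gegenbauerMean_zonal_mul_of_degree_lt h hsub
  rw [mul_sub, map_sub, mul_comm, horth' k hkn, mul_left_comm, gegenbauerMean_C_mul,
    gegenbauerMean_zonal_mul_zonal, if_pos rfl, zero_sub, neg_eq_zero] at h3
  have hlk : (zonal lam k).coeff k ≠ 0 := Polynomial.coeff_ne_zero_of_eq_degree (hdeg k)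
  rcases mul_eq_zero.1 h3 with h4 | h4
  · rw [div_eq_zero_iff] at h4
    rcases h4 with h4 | h4
    · exact hne (Polynomial.leadingCoeff_eq_zero.1 h4)
    · exact hlk h4
  · exact (PowerSeries.eval_one_zonal_pos h k).ne' h4

end Mean

end ProductGegenbauer

/-! ### Gegenbauer polynomials in terms of zonal polynomials -/

namespace ProductGegenbauer

/-- The function `t ↦ Z_n(s) Z_n(t) / Z_n(1)`, the reproducing kernel of the space of orthogonal
polynomials of degree `n` in one variable for the normalized Gegenbauer weight. -/
noncomputable def zonalKernel (lam : ℝ) (n : ℕ) (s t : ℝ) : ℝ :=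
  (zonal lam n).eval s * (zonal lam n).eval t / (zonal lam n).eval 1

lemma zonalKernel_one_right {lam : ℝ} (h : -(1 / 2) < lam) (n : ℕ) (s : ℝ) :
    zonalKernel lam n s 1 = (zonal lam n).eval s :=
  mul_div_cancel_right₀ _ (PowerSeries.eval_one_zonal_pos h n).ne'

lemma choose_add_ne_zero {ν : ℝ} (hν : ∀ k : ℕ, ν + k ≠ 0) (n : ℕ) :
    Ring.choose (ν + n - 1) n ≠ 0 := by
  induction n with
  | zero => simp
  | succ n ih =>
    have h := PowerSeries.succ_mul_choose_add ν n
    exact right_ne_zero_of_mul (h ▸ mul_ne_zero (hν n) ih)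

section

variable {lam : ℝ} (h : -(1 / 2) < lam)

include h

lemma isGegenbauer_gegenbauerC (n : ℕ) : IsGegenbauer lam n (gegenbauerC lam n) := by
  refine Classical.epsilon_spec (p := IsGegenbauer lam n) ?_
  have hZ := PowerSeries.eval_one_zonal_pos h n
  set v : ℝ := if lam = 0 then 1 else Ring.choose ((n : ℝ) + 2 * lam - 1) n with hv
  have hv0 : v ≠ 0 := by
    rw [hv]
    split_ifs with h0
    · exact one_ne_zero
    · rw [add_comm (n : ℝ)]
      refine choose_add_ne_zero (fun k => ?_) n
      cases k with
      | zero => simpa using h0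
      | succ k =>
        have : (0 : ℝ) ≤ k := k.cast_nonneg
        push_cast
        linarith
  refine ⟨Polynomial.C (v / (zonal lam n).eval 1) * zonal lam n, ?_, fun Q hQ => ?_, ?_⟩
  · rw [Polynomial.degree_C_mul (div_ne_zero hv0 hZ.ne'), PowerSeries.degree_zonal (by linarith)]
  · have h1 := gegenbauerMean_zonal_mul_of_degree_lt h hQ
    rw [gegenbauerMean_apply] at h1
    have h2 := (mul_eq_zero.1 h1).resolve_left (gegenbauerConst_pos h).ne'
    simp only [Polynomial.eval_mul, Polynomial.eval_C, mul_assoc] at h2 ⊢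
    rw [intervalIntegral.integral_const_mul, h2, mul_zero]
  · rw [Polynomial.eval_mul, Polynomial.eval_C, div_mul_cancel₀ _ hZ.ne']

lemma gegenbauerC_eq (n : ℕ) :
    ∃ c : ℝ, c ≠ 0 ∧ gegenbauerC lam n = Polynomial.C c * zonal lam n := by
  have hC := isGegenbauer_gegenbauerC h n
  obtain ⟨c, hc⟩ := eq_C_mul_zonal h hC.degree_eq.le fun j hj => by
    rw [gegenbauerMean_apply]
    simp only [Polynomial.eval_mul]
    rw [hC.orthogonal _ (by rw [PowerSeries.degree_zonal (by linarith)]; exact_mod_cast hj),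
      mul_zero]
  refine ⟨c, ?_, hc⟩
  rintro rfl
  have := hC.degree_eq
  rw [hc] at this
  simp at this

lemma zonalKernel_eq (n : ℕ) (s t : ℝ) :
    1 / gegenbauerNormSq lam n * (gegenbauerC lam n).eval s * (gegenbauerC lam n).eval t =
      zonalKernel lam n s t := by
  obtain ⟨c, hc, hC⟩ := gegenbauerC_eq h n
  have hZ := PowerSeries.eval_one_zonal_pos h n
  have hn : gegenbauerNormSq lam n = c ^ 2 * (zonal lam n).eval 1 := by
    have h1 := gegenbauerMean_zonal_mul_zonal h n n
    rw [if_pos rfl] at h1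
    rw [← h1, ← gegenbauerMean_C_mul, gegenbauerMean_apply, gegenbauerNormSq, hC]
    congr 1
    simp only [Polynomial.eval_mul, Polynomial.eval_C]
    congr 1
    ext t
    ring
  rw [hn, hC, zonalKernel, Polynomial.eval_mul, Polynomial.eval_mul, Polynomial.eval_C,
    Polynomial.eval_C]
  field_simp

end

/-- Cesàro means as coefficients of a product of power series. -/
lemma sum_choose_mul_eq_coeff (δ : ℝ) (f : ℕ → ℝ) (n : ℕ) :
    ∑ k ∈ Finset.range (n + 1), Ring.choose (((n - k : ℕ) : ℝ) + δ) (n - k) * f k =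
      PowerSeries.coeff n (negBinomial ℝ (δ + 1) * PowerSeries.mk f) := by
  rw [mul_comm, PowerSeries.coeff_mul, Finset.Nat.sum_antidiagonal_eq_sum_range_succ_mk]
  refine Finset.sum_congr rfl fun k _ => ?_
  rw [PowerSeries.coeff_mk, PowerSeries.coeff_negBinomial, Algebra.algebraMap_self,
    RingHom.id_apply, mul_comm]
  congr 2
  ring

lemma choose_add_pos {δ : ℝ} (hδ : -1 < δ) (n : ℕ) : 0 < Ring.choose ((n : ℝ) + δ) n := by
  have := PowerSeries.choose_add_pos (ν := δ + 1) (by linarith) n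
  rwa [show δ + 1 + n - 1 = n + δ by ring] at this

/-- The generating series of the kernels `zonalKernel lam n s t`. -/
noncomputable def zonalKernelSeries (lam s t : ℝ) : PowerSeries ℝ :=
  PowerSeries.mk fun n => zonalKernel lam n s t

lemma zonalKernelSeries_one_right {lam : ℝ} (h : -(1 / 2) < lam) (s : ℝ) :
    zonalKernelSeries lam s 1 = (1 - PowerSeries.X ^ 2) * gegenbauerSeries (lam + 1) s := by
  ext n
  rw [zonalKernelSeries, PowerSeries.coeff_mk, zonalKernel_one_right h, PowerSeries.eval_zonal]

lemma gegenbauerCesaroKernel_eq {lam : ℝ} (h : -(1 / 2) < lam) (δ : ℝ) (n : ℕ) (s t : ℝ) :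
    gegenbauerCesaroKernel lam δ n s t = 1 / Ring.choose ((n : ℝ) + δ) n *
      PowerSeries.coeff n (negBinomial ℝ (δ + 1) * zonalKernelSeries lam s t) := by
  rw [gegenbauerCesaroKernel, zonalKernelSeries, ← sum_choose_mul_eq_coeff]
  simp only [zonalKernel_eq h]

end ProductGegenbauer

/-! ### The product formula for Gegenbauer polynomials -/

namespace ProductGegenbauer

/-- The Gegenbauer differential operator `(1 - x ^ 2) f'' - (2 lam + 1) x f'`. -/
noncomputable def gegenbauerOperator (lam : ℝ) : Polynomial ℝ →ₗ[ℝ] Polynomial ℝ :=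
  LinearMap.mulLeft ℝ (1 - Polynomial.X ^ 2) ∘ₗ Polynomial.derivative ∘ₗ Polynomial.derivative -
    LinearMap.mulLeft ℝ (Polynomial.C (2 * lam + 1) * Polynomial.X) ∘ₗ Polynomial.derivative

lemma gegenbauerOperator_apply (lam : ℝ) (f : Polynomial ℝ) :
    gegenbauerOperator lam f =
      (1 - Polynomial.X ^ 2) * Polynomial.derivative (Polynomial.derivative f) -
        Polynomial.C (2 * lam + 1) * Polynomial.X * Polynomial.derivative f := rfl

lemma gegenbauerOperator_X_pow (lam : ℝ) (n : ℕ) :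
    gegenbauerOperator lam (Polynomial.X ^ n) =
      Polynomial.C (n * (n - 1) : ℝ) * Polynomial.X ^ (n - 2) -
        Polynomial.C (n * (n + 2 * lam)) * Polynomial.X ^ n := by
  rcases n with _ | _ | n
  · simp [gegenbauerOperator_apply]
  · simp [gegenbauerOperator_apply]
    ring
  · simp [gegenbauerOperator_apply]
    ring

/-- An eigenpolynomial of the Gegenbauer operator of degree at most `n` for the `n`-th eigenvalue
is a multiple of the `n`-th zonal polynomial. -/
lemma eq_C_mul_zonal_of_gegenbauerOperator {lam : ℝ} (h : -(1 / 2) < lam) {n : ℕ}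
    {f : Polynomial ℝ} (hf : f.degree ≤ n)
    (hD : gegenbauerOperator lam f = -Polynomial.C (n * (n + 2 * lam)) * f) :
    ∃ c : ℝ, f = Polynomial.C c * zonal lam n := by
  refine eq_C_mul_zonal h hf fun j hj => ?_
  have e2 := PowerSeries.zonal_ode lam j
  rw [gegenbauerOperator_apply] at hD
  set g := zonal lam j
  have h1 := gegenbauerMean_derivative h
    (Polynomial.derivative f * g - f * Polynomial.derivative g)
  have e : (1 - Polynomial.X ^ 2) * Polynomial.derivative
      (Polynomial.derivative f * g - f * Polynomial.derivative g) -
      Polynomial.C (2 * lam + 1) * Polynomial.X *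
      (Polynomial.derivative f * g - f * Polynomial.derivative g) =
      Polynomial.C (((j : ℝ) - n) * (j + n + 2 * lam)) * (f * g) := by
    simp only [Polynomial.derivative_mul, Polynomial.derivative_sub, Polynomial.C_mul,
      Polynomial.C_add, Polynomial.C_sub, Polynomial.C_1, map_ofNat Polynomial.C] at hD e2 ⊢
    linear_combination g * hD - f * e2
  rw [e, gegenbauerMean_C_mul] at h1
  refine (mul_eq_zero.1 h1).resolve_left (mul_ne_zero ?_ ?_)
  · rw [sub_ne_zero]; exact_mod_cast hj.ne
  · have : (1 : ℝ) ≤ j + n := by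
      have : 1 ≤ j + n := by omega
      exact_mod_cast this
    linarith

/-- `Λ` is a positive linear functional on polynomials with the moments of the probability measure
proportional to `(1 - t ^ 2) ^ (lam - 1) dt` on `[-1, 1]`; for `lam = 0` that is the measure with
mass `1 / 2` at each of the two end points. -/
structure IsProductFunctional (lam : ℝ) (Λ : Polynomial ℝ →ₗ[ℝ] ℝ) : Prop where
  map_one : Λ 1 = 1
  map_X : Λ Polynomial.X = 0
  moment : ∀ j : ℕ, (j + 1) * Λ (Polynomial.X ^ j) = (j + 1 + 2 * lam) * Λ (Polynomial.X ^ (j + 2))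
  nonneg : ∀ p : Polynomial ℝ, (∀ t ∈ Set.Icc (-1 : ℝ) 1, 0 ≤ p.eval t) → 0 ≤ Λ p

lemma exists_isProductFunctional {lam : ℝ} (h : 0 ≤ lam) : ∃ Λ, IsProductFunctional lam Λ := by
  rcases h.eq_or_lt with rfl | h
  · refine ⟨(1 / 2 : ℝ) • (Polynomial.leval 1 + Polynomial.leval (-1)), ?_, ?_, fun j => ?_,
      fun p hp => ?_⟩
    · simp [Polynomial.leval]; norm_num
    · simp [Polynomial.leval]
    · simp [Polynomial.leval, pow_add]
    · have h1 := hp 1 (by norm_num)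
      have h2 := hp (-1) (by norm_num)
      simp only [Polynomial.leval, LinearMap.smul_apply, LinearMap.add_apply, LinearMap.coe_mk,
        AddHom.coe_mk, smul_eq_mul]
      linarith
  · have h' : -(1 / 2) < lam - 1 / 2 := by linarith
    refine ⟨gegenbauerMean h', gegenbauerMean_one h', ?_, fun j => ?_,
      fun p hp => gegenbauerMean_nonneg h' hp⟩
    · have h1 := gegenbauerMean_derivative h' 1
      rw [Polynomial.derivative_one, mul_zero, zero_sub, map_neg, neg_eq_zero, mul_one,
        gegenbauerMean_C_mul] at h1
      exact (mul_eq_zero.1 h1).resolve_left (by linarith)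
    · have h1 := gegenbauerMean_derivative h' (Polynomial.X ^ (j + 1))
      have e : (1 - Polynomial.X ^ 2) * Polynomial.derivative (Polynomial.X ^ (j + 1)) -
          Polynomial.C (2 * (lam - 1 / 2) + 1) * Polynomial.X * Polynomial.X ^ (j + 1) =
          Polynomial.C ((j : ℝ) + 1) * Polynomial.X ^ j -
            Polynomial.C (j + 1 + 2 * lam) * Polynomial.X ^ (j + 2) := by
        rw [show 2 * (lam - 1 / 2) + 1 = 2 * lam by ring]
        simp
        ring
      rw [e, map_sub, gegenbauerMean_C_mul, gegenbauerMean_C_mul, sub_eq_zero] at h1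
      exact h1

namespace IsProductFunctional

variable {lam : ℝ} {Λ : Polynomial ℝ →ₗ[ℝ] ℝ} (hΛ : IsProductFunctional lam Λ)

include hΛ in
lemma map_X_pow_odd (h : 0 ≤ lam) (i : ℕ) : Λ (Polynomial.X ^ (2 * i + 1)) = 0 := by
  induction i with
  | zero => simpa using hΛ.map_X
  | succ i ih =>
    have h1 := hΛ.moment (2 * i + 1)
    rw [ih, mul_zero] at h1
    refine (mul_eq_zero.1 h1.symm).resolve_left ?_
    positivity

end IsProductFunctional

/-- The image of `s ^ n` under the generalized translation
`f ↦ Λ_t f (x y + √(1 - x ^ 2) √(1 - y ^ 2) t)`, as a polynomial in `x`. -/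
noncomputable def translateMonomial (Λ : Polynomial ℝ →ₗ[ℝ] ℝ) (y : ℝ) (n : ℕ) : Polynomial ℝ :=
  ∑ i ∈ Finset.range (n + 1), Polynomial.C (n.choose (2 * i) * Λ (Polynomial.X ^ (2 * i))) *
    ((Polynomial.C y * Polynomial.X) ^ (n - 2 * i) *
      (Polynomial.C (1 - y ^ 2) * (1 - Polynomial.X ^ 2)) ^ i)

/-- The generalized translation as a linear map. -/
noncomputable def translate (Λ : Polynomial ℝ →ₗ[ℝ] ℝ) (y : ℝ) : Polynomial ℝ →ₗ[ℝ] Polynomial ℝ :=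
  Polynomial.lsum fun n => (LinearMap.toSpanSingleton ℝ (Polynomial ℝ) (translateMonomial Λ y n))

lemma translate_X_pow (Λ : Polynomial ℝ →ₗ[ℝ] ℝ) (y : ℝ) (n : ℕ) :
    translate Λ y (Polynomial.X ^ n) = translateMonomial Λ y n := by
  rw [translate, Polynomial.lsum_apply, ← Polynomial.monomial_one_right_eq_X_pow,
    Polynomial.sum_monomial_index] <;> simp

lemma gegenbauerOperator_translate_term (lam y : ℝ) (p i : ℕ) :
    gegenbauerOperator lam ((Polynomial.C y * Polynomial.X) ^ p *
      (Polynomial.C (1 - y ^ 2) * (1 - Polynomial.X ^ 2)) ^ i) =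
    Polynomial.C (p * (p - 1) : ℝ) * ((Polynomial.C y * Polynomial.X) ^ (p - 2) *
      (Polynomial.C (1 - y ^ 2) * (1 - Polynomial.X ^ 2)) ^ i) -
    Polynomial.C (p * (p - 1) * (1 - y ^ 2) : ℝ) * ((Polynomial.C y * Polynomial.X) ^ (p - 2) *
      (Polynomial.C (1 - y ^ 2) * (1 - Polynomial.X ^ 2)) ^ i) +
    Polynomial.C (2 * i * (2 * i + 2 * lam - 1) * (1 - y ^ 2) : ℝ) *
      ((Polynomial.C y * Polynomial.X) ^ p *
      (Polynomial.C (1 - y ^ 2) * (1 - Polynomial.X ^ 2)) ^ (i - 1)) -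
    Polynomial.C ((p + 2 * i) * (p + 2 * i + 2 * lam) : ℝ) *
      ((Polynomial.C y * Polynomial.X) ^ p *
      (Polynomial.C (1 - y ^ 2) * (1 - Polynomial.X ^ 2)) ^ i) := by
  have c2 : (Polynomial.C 2 : Polynomial ℝ) = 2 := map_ofNat _ 2
  rcases p with _ | _ | p <;> rcases i with _ | _ | i <;>
  simp [gegenbauerOperator_apply, Polynomial.derivative_pow, Polynomial.derivative_mul,
    mul_pow, c2] <;> ring

lemma cast_choose_mul_sub (n k : ℕ) :
    (n.choose k : ℝ) * ((n - k : ℕ) * ((n - k : ℕ) - 1)) = n * (n - 1) * (n - 2).choose k := by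
  rcases lt_or_ge n (k + 2) with h | h
  · have h1 : (n : ℝ) * (n - 1) * (n - 2).choose k = 0 := by
      rcases n with _ | _ | n
      · simp
      · simp
      · rw [Nat.choose_eq_zero_of_lt (by omega)]; simp
    rw [h1]
    obtain h2 | h2 : n - k = 0 ∨ n - k = 1 := by omega
    all_goals simp [h2]
  · obtain ⟨m, rfl⟩ : ∃ m, n = k + m + 2 := ⟨n - k - 2, by omega⟩
    have h1 := Nat.choose_mul_succ_eq (k + m) k
    have h2 := Nat.choose_mul_succ_eq (k + m + 1) k
    rw [show k + m + 1 - k = m + 1 by omega] at h1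
    rw [show k + m + 1 + 1 - k = m + 2 by omega] at h2
    rw [show k + m + 2 - k = m + 2 by omega, show k + m + 2 - 2 = k + m by omega]
    have h1' : ((k + m).choose k : ℝ) * (k + m + 1) = (k + m + 1).choose k * (m + 1) := by
      exact_mod_cast h1
    have h2' : ((k + m + 1).choose k : ℝ) * (k + m + 2) = (k + m + 2).choose k * (m + 2) := by
      exact_mod_cast h2
    push_cast
    linear_combination -(m + 1 : ℝ) * h2' - (k + m + 2 : ℝ) * h1'

lemma cast_choose_add_two (n k : ℕ) :
    (n.choose (k + 2) : ℝ) * ((k + 2) * (k + 1)) =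
      n.choose k * ((n - k : ℕ) * ((n - k : ℕ) - 1)) := by
  have h1 := Nat.choose_succ_right_eq n k
  have h2 := Nat.choose_succ_right_eq n (k + 1)
  have h1' : (n.choose (k + 1) : ℝ) * (k + 1) = n.choose k * (n - k : ℕ) := by exact_mod_cast h1
  have h2' : (n.choose (k + 2) : ℝ) * (k + 2) = n.choose (k + 1) * (n - (k + 1) : ℕ) := by
    exact_mod_cast h2
  rcases lt_or_ge k n with h | h
  · have h3 : ((n - (k + 1) : ℕ) : ℝ) = (n - k : ℕ) - 1 := by
      rw [show n - k = n - (k + 1) + 1 by omega]; simp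
    rw [h3] at h2'
    linear_combination (k + 1 : ℝ) * h2' + ((n - k : ℕ) - 1 : ℝ) * h1'
  · rw [Nat.choose_eq_zero_of_lt (by omega), show n - k = 0 by omega]; simp

lemma gegenbauerOperator_translateMonomial {lam : ℝ} {Λ : Polynomial ℝ →ₗ[ℝ] ℝ}
    (hΛ : IsProductFunctional lam Λ) (y : ℝ) (n : ℕ) :
    gegenbauerOperator lam (translateMonomial Λ y n) =
      Polynomial.C (n * (n - 1) : ℝ) * translateMonomial Λ y (n - 2) -
        Polynomial.C (n * (n + 2 * lam)) * translateMonomial Λ y n := by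
  set t : ℕ → ℕ → Polynomial ℝ := fun p i => (Polynomial.C y * Polynomial.X) ^ p *
      (Polynomial.C (1 - y ^ 2) * (1 - Polynomial.X ^ 2)) ^ i with ht
  set m : ℕ → ℝ := fun i => Λ (Polynomial.X ^ (2 * i)) with hm
  have hmom : ∀ i : ℕ, (2 * i + 1) * m i = (2 * i + 1 + 2 * lam) * m (i + 1) := fun i => by
    have := hΛ.moment (2 * i)
    push_cast at this
    exact this
  -- The summands not of the required form telescope.
  set f : ℕ → Polynomial ℝ := fun i => Polynomial.C
    (n.choose (2 * i) * m i * (2 * i * (2 * i + 2 * lam - 1)) * (1 - y ^ 2)) *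
      t (n - 2 * i) (i - 1) with hf
  have hT : ∀ k, translateMonomial Λ y k =
      ∑ i ∈ Finset.range (k + 1), Polynomial.C (k.choose (2 * i) * m i) * t (k - 2 * i) i :=
    fun k => rfl
  have hext : Polynomial.C (n * (n - 1) : ℝ) * translateMonomial Λ y (n - 2) =
      ∑ i ∈ Finset.range (n + 1), Polynomial.C (n * (n - 1) : ℝ) *
        (Polynomial.C ((n - 2).choose (2 * i) * m i) * t (n - 2 - 2 * i) i) := by
    rw [hT, Finset.mul_sum]
    refine Finset.sum_subset (fun i hi => ?_) fun i _ hi => ?_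
    · simp only [Finset.mem_range] at hi ⊢; omega
    · rw [Finset.mem_range] at hi
      rw [Nat.choose_eq_zero_of_lt (by omega)]
      simp
  have hterm : ∀ i, gegenbauerOperator lam
      (Polynomial.C (n.choose (2 * i) * m i) * t (n - 2 * i) i) =
      Polynomial.C (n * (n - 1) : ℝ) *
        (Polynomial.C ((n - 2).choose (2 * i) * m i) * t (n - 2 - 2 * i) i) -
      Polynomial.C (n * (n + 2 * lam)) *
        (Polynomial.C (n.choose (2 * i) * m i) * t (n - 2 * i) i) + (f i - f (i + 1)) := by
    intro i
    have e0 := gegenbauerOperator_translate_term lam y (n - 2 * i) i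
    have eA := cast_choose_mul_sub n (2 * i)
    have eB := cast_choose_add_two n (2 * i)
    rw [← Polynomial.smul_eq_C_mul, map_smul, Polynomial.smul_eq_C_mul, Polynomial.smul_eq_C_mul]
    change gegenbauerOperator lam (t (n - 2 * i) i) = Polynomial.C _ * t (n - 2 * i - 2) i -
      Polynomial.C _ * t (n - 2 * i - 2) i + Polynomial.C _ * t (n - 2 * i) (i - 1) -
      Polynomial.C _ * t (n - 2 * i) i at e0
    rw [e0]
    have hfs : f (i + 1) = Polynomial.C (n.choose (2 * i) * m i *
        ((n - 2 * i : ℕ) * ((n - 2 * i : ℕ) - 1)) * (1 - y ^ 2)) * t (n - 2 * i - 2) i := by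
      simp only [hf]
      rw [show n - 2 * (i + 1) = n - 2 * i - 2 by omega, Nat.add_sub_cancel,
        show 2 * (i + 1) = 2 * i + 2 by ring]
      congr 2
      have := hmom i
      push_cast at eB ⊢
      linear_combination (-(n.choose (2 * i + 2) : ℝ) * (2 * i + 2) * (1 - y ^ 2)) * this +
        m i * (1 - y ^ 2) * eB
    rw [hfs, show n - 2 - 2 * i = n - 2 * i - 2 by omega]
    simp only [hf]
    have eD : (n.choose (2 * i) : ℝ) *
        (((n - 2 * i : ℕ) + 2 * i) * ((n - 2 * i : ℕ) + 2 * i + 2 * lam)) =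
        n.choose (2 * i) * (n * (n + 2 * lam)) := by
      rcases lt_or_ge n (2 * i) with h | h
      · rw [Nat.choose_eq_zero_of_lt h]; simp
      · rw [Nat.cast_sub h]; push_cast; ring
    have eA' := congrArg Polynomial.C eA
    have eD' := congrArg Polynomial.C eD
    simp only [Polynomial.C_mul] at eA' eD' ⊢
    linear_combination (Polynomial.C (m i) * t (n - 2 * i - 2) i) * eA' -
      (Polynomial.C (m i) * t (n - 2 * i) i) * eD'
  rw [hext, hT n, map_sum, Finset.mul_sum, ← Finset.sum_sub_distrib,
    Finset.sum_congr rfl fun i _ => hterm i, Finset.sum_add_distrib, Finset.sum_range_sub']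
  have hf0 : f 0 = 0 := by simp [hf]
  have hfn : f (n + 1) = 0 := by
    simp only [hf]
    rw [Nat.choose_eq_zero_of_lt (by omega)]; simp
  rw [hf0, hfn, sub_zero, add_zero]

lemma gegenbauerOperator_translate {lam : ℝ} {Λ : Polynomial ℝ →ₗ[ℝ] ℝ}
    (hΛ : IsProductFunctional lam Λ) (y : ℝ) (f : Polynomial ℝ) :
    gegenbauerOperator lam (translate Λ y f) = translate Λ y (gegenbauerOperator lam f) := by
  suffices H : gegenbauerOperator lam ∘ₗ translate Λ y =
      translate Λ y ∘ₗ gegenbauerOperator lam from LinearMap.congr_fun H f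
  refine Polynomial.lhom_ext' fun n => LinearMap.ext_ring ?_
  simp only [LinearMap.comp_apply, Polynomial.monomial_one_right_eq_X_pow]
  rw [gegenbauerOperator_X_pow, map_sub, ← Polynomial.smul_eq_C_mul, ← Polynomial.smul_eq_C_mul,
    map_smul, map_smul, translate_X_pow, translate_X_pow, gegenbauerOperator_translateMonomial hΛ,
    Polynomial.smul_eq_C_mul, Polynomial.smul_eq_C_mul]

lemma degree_translateMonomial_le (Λ : Polynomial ℝ →ₗ[ℝ] ℝ) (y : ℝ) (n : ℕ) :
    (translateMonomial Λ y n).natDegree ≤ n := by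
  refine Polynomial.natDegree_sum_le_of_forall_le _ _ fun i _ => ?_
  rcases lt_or_ge n (2 * i) with h | h
  · rw [Nat.choose_eq_zero_of_lt h]; simp
  · have h1 : (Polynomial.C y * Polynomial.X : Polynomial ℝ).natDegree ≤ 1 :=
      (Polynomial.natDegree_C_mul_le _ _).trans Polynomial.natDegree_X_le
    have h2 : (Polynomial.C (1 - y ^ 2) * (1 - Polynomial.X ^ 2) : Polynomial ℝ).natDegree ≤ 2 := by
      refine (Polynomial.natDegree_C_mul_le _ _).trans
        ((Polynomial.natDegree_sub_le _ _).trans (max_le (by simp) (by simp)))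
    refine (Polynomial.natDegree_C_mul_le _ _).trans (Polynomial.natDegree_mul_le.trans ?_)
    have h3 := Polynomial.natDegree_pow_le_of_le (n - 2 * i) h1
    have h4 := Polynomial.natDegree_pow_le_of_le i h2
    omega

lemma translate_apply (Λ : Polynomial ℝ →ₗ[ℝ] ℝ) (y : ℝ) (f : Polynomial ℝ) :
    translate Λ y f =
      ∑ n ∈ Finset.range (f.natDegree + 1), f.coeff n • translateMonomial Λ y n := by
  rw [translate, Polynomial.lsum_apply, Polynomial.sum_over_range _ (by simp)]
  rfl

lemma degree_translate_le (Λ : Polynomial ℝ →ₗ[ℝ] ℝ) (y : ℝ) (f : Polynomial ℝ) :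
    (translate Λ y f).natDegree ≤ f.natDegree := by
  rw [translate_apply]
  refine Polynomial.natDegree_sum_le_of_forall_le _ _ fun n hn => ?_
  exact (Polynomial.natDegree_smul_le _ _).trans ((degree_translateMonomial_le Λ y n).trans
    (Nat.lt_succ_iff.1 (Finset.mem_range.1 hn)))

lemma eval_one_translate {lam : ℝ} {Λ : Polynomial ℝ →ₗ[ℝ] ℝ}
    (hΛ : IsProductFunctional lam Λ) (y : ℝ) (f : Polynomial ℝ) :
    (translate Λ y f).eval 1 = f.eval y := by
  suffices H : Polynomial.leval 1 ∘ₗ translate Λ y = Polynomial.leval y from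
    LinearMap.congr_fun H f
  refine Polynomial.lhom_ext' fun n => LinearMap.ext_ring ?_
  simp only [LinearMap.comp_apply, Polynomial.monomial_one_right_eq_X_pow, translate_X_pow,
    Polynomial.leval_apply, translateMonomial]
  rw [Polynomial.eval_finsetSum, Finset.sum_eq_single 0]
  · simp [hΛ.map_one]
  · intro i _ hi
    simp [hi]
  · simp

/-- The generalized translation averages the values of `f` over points of `[-1, 1]`, so that it
preserves nonnegativity. The odd moments of `Λ`, which come with odd powers of the square root,
vanish. -/
lemma eval_translate {lam : ℝ} (h : 0 ≤ lam) {Λ : Polynomial ℝ →ₗ[ℝ] ℝ}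
    (hΛ : IsProductFunctional lam Λ) {x y : ℝ} (hx : x ∈ Set.Icc (-1 : ℝ) 1)
    (hy : y ∈ Set.Icc (-1 : ℝ) 1) (f : Polynomial ℝ) :
    (translate Λ y f).eval x = Λ (f.comp (Polynomial.C (x * y) +
      Polynomial.C √((1 - x ^ 2) * (1 - y ^ 2)) * Polynomial.X)) := by
  set ρ := √((1 - x ^ 2) * (1 - y ^ 2)) with hρ
  have hρ2 : ρ ^ 2 = (1 - x ^ 2) * (1 - y ^ 2) :=
    Real.sq_sqrt (mul_nonneg (by nlinarith [hx.1, hx.2]) (by nlinarith [hy.1, hy.2]))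
  suffices H : Polynomial.leval x ∘ₗ translate Λ y = Λ ∘ₗ (Polynomial.aeval (R := ℝ)
      (Polynomial.C (x * y) + Polynomial.C ρ * Polynomial.X)).toLinearMap from
    LinearMap.congr_fun H f
  refine Polynomial.lhom_ext' fun n => LinearMap.ext_ring ?_
  simp only [LinearMap.comp_apply, Polynomial.monomial_one_right_eq_X_pow, translate_X_pow,
    Polynomial.leval_apply, translateMonomial, AlgHom.toLinearMap_apply, map_pow,
    Polynomial.aeval_X]
  set g : ℕ → ℝ := fun j => n.choose j * ((x * y) ^ (n - j) * ρ ^ j * Λ (Polynomial.X ^ j)) with hg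
  have e1 : Λ ((Polynomial.C (x * y) + Polynomial.C ρ * Polynomial.X) ^ n) =
      ∑ j ∈ Finset.range (n + 1), g j := by
    rw [add_comm, add_pow, map_sum]
    refine Finset.sum_congr rfl fun j _ => ?_
    have : (Polynomial.C ρ * Polynomial.X) ^ j * Polynomial.C (x * y) ^ (n - j) *
        ((n.choose j : ℕ) : Polynomial ℝ) =
        (n.choose j * ((x * y) ^ (n - j) * ρ ^ j)) • (Polynomial.X : Polynomial ℝ) ^ j := by
      rw [Polynomial.smul_eq_C_mul]
      simp only [Polynomial.C_mul, map_pow, map_natCast]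
      ring
    rw [this, map_smul, smul_eq_mul, hg]
    ring
  have e2 : ∀ N, ∑ j ∈ Finset.range (2 * N), g j = ∑ i ∈ Finset.range N, g (2 * i) := by
    intro N
    induction N with
    | zero => simp
    | succ N ih =>
      rw [show 2 * (N + 1) = 2 * N + 1 + 1 by ring, Finset.sum_range_succ, Finset.sum_range_succ,
        ih, Finset.sum_range_succ]
      have : g (2 * N + 1) = 0 := by simp only [hg]; rw [hΛ.map_X_pow_odd h]; ring
      rw [this, add_zero]
  have e3 : ∑ j ∈ Finset.range (n + 1), g j = ∑ j ∈ Finset.range (2 * (n + 1)), g j := by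
    refine Finset.sum_subset (fun i hi => ?_) fun i _ hi => ?_
    · simp only [Finset.mem_range] at hi ⊢; omega
    · rw [Finset.mem_range] at hi
      simp only [hg]
      rw [Nat.choose_eq_zero_of_lt (by omega)]
      simp
  rw [e1, e3, e2, Polynomial.eval_finsetSum]
  refine Finset.sum_congr rfl fun i _ => ?_
  simp only [hg]
  rw [pow_mul ρ, hρ2]
  simp only [Polynomial.eval_mul, Polynomial.eval_C, Polynomial.eval_pow, Polynomial.eval_X,
    Polynomial.eval_sub, Polynomial.eval_one]
  ring

/-- The product formula `Z_n(x) Z_n(y) / Z_n(1) = Λ_t Z_n(x y + √(1 - x ^ 2) √(1 - y ^ 2) t)`: both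
sides are eigenpolynomials of the Gegenbauer operator in `x`. -/
theorem zonalKernel_eq_translate {lam : ℝ} (h : 0 ≤ lam) {Λ : Polynomial ℝ →ₗ[ℝ] ℝ}
    (hΛ : IsProductFunctional lam Λ) (x y : ℝ) (n : ℕ) :
    zonalKernel lam n x y = (translate Λ y (zonal lam n)).eval x := by
  have h' : -(1 / 2) < lam := by linarith
  have hdeg := PowerSeries.degree_zonal (by linarith : -1 < lam) n
  obtain ⟨c, hc⟩ := eq_C_mul_zonal_of_gegenbauerOperator h' (n := n)
    (f := translate Λ y (zonal lam n))
    (Polynomial.natDegree_le_iff_degree_le.1 ((degree_translate_le Λ y _).trans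
      (Polynomial.natDegree_le_iff_degree_le.2 hdeg.le)))
    (by
      rw [gegenbauerOperator_translate hΛ, gegenbauerOperator_apply, PowerSeries.zonal_ode,
        ← Polynomial.C_neg, ← Polynomial.smul_eq_C_mul, map_smul, Polynomial.smul_eq_C_mul])
  have h1 := eval_one_translate hΛ y (zonal lam n)
  rw [hc, Polynomial.eval_mul, Polynomial.eval_C] at h1
  have hZ := PowerSeries.eval_one_zonal_pos h' n
  rw [hc, Polynomial.eval_mul, Polynomial.eval_C, zonalKernel, ← h1]
  field_simp

lemma abs_mul_add_sqrt_mul_le_one {x y t : ℝ} (hx : x ∈ Set.Icc (-1 : ℝ) 1)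
    (hy : y ∈ Set.Icc (-1 : ℝ) 1) (ht : t ∈ Set.Icc (-1 : ℝ) 1) :
    |x * y + √((1 - x ^ 2) * (1 - y ^ 2)) * t| ≤ 1 := by
  have hx2 : 0 ≤ 1 - x ^ 2 := by nlinarith [hx.1, hx.2]
  have hy2 : 0 ≤ 1 - y ^ 2 := by nlinarith [hy.1, hy.2]
  have h1 : √((1 - x ^ 2) * (1 - y ^ 2)) ≤ 1 - |x * y| := by
    have hxy : |x * y| ≤ 1 := by
      rw [abs_mul]
      exact mul_le_one₀ (abs_le.2 hx) (abs_nonneg _) (abs_le.2 hy)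
    refine Real.sqrt_le_iff.2 ⟨by linarith, ?_⟩
    have h3 : |x * y| ^ 2 = x ^ 2 * y ^ 2 := by rw [sq_abs]; ring
    have h4 : 2 * |x * y| ≤ x ^ 2 + y ^ 2 := by
      rw [abs_mul, ← sq_abs x, ← sq_abs y]
      nlinarith [sq_nonneg (|x| - |y|)]
    nlinarith
  calc |x * y + √((1 - x ^ 2) * (1 - y ^ 2)) * t|
      ≤ |x * y| + |√((1 - x ^ 2) * (1 - y ^ 2)) * t| := abs_add_le _ _
    _ ≤ |x * y| + (1 - |x * y|) * 1 := by
        rw [abs_mul (√_), abs_of_nonneg (Real.sqrt_nonneg _)]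
        have := abs_nonneg t
        have ht' : |t| ≤ 1 := abs_le.2 ht
        have h0 := Real.sqrt_nonneg ((1 - x ^ 2) * (1 - y ^ 2))
        have : √((1 - x ^ 2) * (1 - y ^ 2)) * |t| ≤ (1 - |x * y|) * 1 :=
          mul_le_mul h1 ht' this (h0.trans h1)
        linarith
    _ = 1 := by ring

/-- The Cesàro means of order `2 lam + 1` of Gegenbauer expansions of index `lam ≥ 0` are
positive; the product formula reduces the assertion to the end point `1`. -/
theorem coeffNonneg_zonalKernelSeries {lam : ℝ} (h : 0 ≤ lam) {x y : ℝ}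
    (hx : x ∈ Set.Icc (-1 : ℝ) 1) (hy : y ∈ Set.Icc (-1 : ℝ) 1) :
    CoeffNonneg (negBinomial ℝ (2 * lam + 2) * zonalKernelSeries lam x y) := by
  obtain ⟨Λ, hΛ⟩ := exists_isProductFunctional h
  have h' : -(1 / 2) < lam := by linarith
  intro n
  have key : ∀ u v, PowerSeries.coeff n (negBinomial ℝ (2 * lam + 2) * zonalKernelSeries lam u v) =
      ∑ k ∈ Finset.range (n + 1),
        Ring.choose (((n - k : ℕ) : ℝ) + (2 * lam + 1)) (n - k) * zonalKernel lam k u v :=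
    fun u v => by
      rw [sum_choose_mul_eq_coeff, zonalKernelSeries]; ring_nf
  set p : Polynomial ℝ := ∑ k ∈ Finset.range (n + 1),
    Ring.choose (((n - k : ℕ) : ℝ) + (2 * lam + 1)) (n - k) • zonal lam k with hp
  have hp1 : ∀ s ∈ Set.Icc (-1 : ℝ) 1, 0 ≤ p.eval s := fun s hs => by
    have := PowerSeries.coeffNonneg_kogbetliantz h (abs_le.2 hs) n
    rw [← zonalKernelSeries_one_right h', key] at this
    simpa only [hp, Polynomial.eval_finsetSum, Polynomial.eval_smul, smul_eq_mul,
      zonalKernel_one_right h'] using this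
  have hp2 : PowerSeries.coeff n (negBinomial ℝ (2 * lam + 2) * zonalKernelSeries lam x y) =
      (translate Λ y p).eval x := by
    rw [key, hp, map_sum, Polynomial.eval_finsetSum]
    refine Finset.sum_congr rfl fun k _ => ?_
    rw [map_smul, Polynomial.eval_smul, smul_eq_mul, zonalKernel_eq_translate h hΛ]
  rw [hp2, eval_translate h hΛ hx hy]
  refine hΛ.nonneg _ fun t ht => ?_
  rw [Polynomial.eval_comp]
  simp only [Polynomial.eval_add, Polynomial.eval_mul, Polynomial.eval_C, Polynomial.eval_X]
  exact hp1 _ (abs_le.1 (abs_mul_add_sqrt_mul_le_one hx hy ht))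

end ProductGegenbauer

/-! ### Reproducing kernels for product weights -/

namespace ProductGegenbauer

section Uniqueness

variable {d : ℕ} {Ω : Set (Fin d → ℝ)} {W : (Fin d → ℝ) → ℝ}

/-- The reproducing kernel does not depend on the orthonormal basis; the integrability hypothesis
makes the bilinear form of the weight bilinear. -/
lemma reproducingKernel_eq
    (hW : ∀ P : MvPolynomial (Fin d) ℝ,
      IntegrableOn (fun x => MvPolynomial.eval x P * W x) Ω volume)
    {n : ℕ} {K : (Fin d → ℝ) → (Fin d → ℝ) → ℝ} (hK : IsReproducingKernel Ω W n K) :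
    reproducingKernel Ω W n = K := by
  obtain ⟨r, P, hP, hKP⟩ := hK
  obtain ⟨r', P', hP', hKP'⟩ := Classical.epsilon_spec (p := IsReproducingKernel Ω W n)
    ⟨K, r, P, hP, hKP⟩
  have hsum : ∀ (s : ℕ) (c : Fin s → ℝ) (R : Fin s → MvPolynomial (Fin d) ℝ) (Q),
      weightInner Ω W (∑ i, c i • R i) Q = ∑ i, c i * weightInner Ω W (R i) Q := by
    intro s c R Q
    simp only [weightInner]
    simp_rw [← integral_const_mul]
    rw [← integral_finsetSum]
    · congr 1
      ext x
      rw [map_sum, Finset.sum_mul, Finset.sum_mul]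
      refine Finset.sum_congr rfl fun i _ => ?_
      rw [MvPolynomial.smul_eval]; ring
    · intro i _
      have := hW (R i * Q)
      simp only [map_mul] at this
      exact this.const_mul (c i)
  have hexp : ∀ j, P j = ∑ k, weightInner Ω W (P j) (P' k) • P' k := by
    intro j
    obtain ⟨c, hc⟩ := (Submodule.mem_span_range_iff_exists_fun ℝ).1 (hP'.span _ (hP.mem j))
    have : ∀ k, weightInner Ω W (P j) (P' k) = c k := fun k => by
      rw [← hc, hsum]
      simp [hP'.orthonormal]
    simp_rw [this, hc]
  have hexp' : ∀ k, P' k = ∑ j, weightInner Ω W (P j) (P' k) • P j := by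
    intro k
    obtain ⟨c, hc⟩ := (Submodule.mem_span_range_iff_exists_fun ℝ).1 (hP.span _ (hP'.mem k))
    have hsymm : ∀ f g, weightInner Ω W f g = weightInner Ω W g f := fun f g => by
      simp only [weightInner, mul_comm]
    have : ∀ j, weightInner Ω W (P j) (P' k) = c j := fun j => by
      rw [hsymm, ← hc, hsum]
      simp [hP.orthonormal]
    simp_rw [this, hc]
  funext x y
  change Classical.epsilon (IsReproducingKernel Ω W n) x y = K x y
  rw [hKP', hKP]
  calc ∑ k, MvPolynomial.eval x (P' k) * MvPolynomial.eval y (P' k)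
      = ∑ k, ∑ j, weightInner Ω W (P j) (P' k) * MvPolynomial.eval x (P j) *
          MvPolynomial.eval y (P' k) := by
        refine Finset.sum_congr rfl fun k _ => ?_
        have hev : MvPolynomial.eval x (P' k) =
            ∑ j, weightInner Ω W (P j) (P' k) * MvPolynomial.eval x (P j) := by
          conv_lhs => rw [hexp' k, map_sum]
          simp only [MvPolynomial.smul_eval]
        rw [← Finset.sum_mul, ← hev]
    _ = ∑ j, ∑ k, weightInner Ω W (P j) (P' k) * MvPolynomial.eval x (P j) *
          MvPolynomial.eval y (P' k) := Finset.sum_comm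
    _ = ∑ j, MvPolynomial.eval x (P j) * MvPolynomial.eval y (P j) := by
        refine Finset.sum_congr rfl fun j _ => ?_
        have hev : MvPolynomial.eval y (P j) =
            ∑ k, weightInner Ω W (P j) (P' k) * MvPolynomial.eval y (P' k) := by
          conv_lhs => rw [hexp j, map_sum]
          simp only [MvPolynomial.smul_eval]
        rw [hev, Finset.mul_sum]
        exact Finset.sum_congr rfl fun k _ => by ring

end Uniqueness

section Product

variable {d : ℕ} {lam : Fin d → ℝ}

lemma cube_eq_pi (d : ℕ) : cube d = Set.univ.pi fun _ => Set.Icc (-1 : ℝ) 1 := by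
  ext x; simp only [cube, Set.mem_univ_pi, Set.mem_ofPred_eq]

lemma restrict_cube (d : ℕ) : (volume : Measure (Fin d → ℝ)).restrict (cube d) =
    Measure.pi fun _ => (volume : Measure ℝ).restrict (Set.Icc (-1) 1) := by
  rw [cube_eq_pi, volume_pi, Measure.restrict_pi_pi]

lemma integrableOn_eval_mul_productWeight (hlam : ∀ i, -(1 / 2 : ℝ) < lam i)
    (P : MvPolynomial (Fin d) ℝ) :
    IntegrableOn (fun x => MvPolynomial.eval x P * productWeight lam x) (cube d) volume := by
  have hcomp : IsCompact (cube d) := by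
    rw [cube_eq_pi]; exact isCompact_univ_pi fun _ => isCompact_Icc
  refine IntegrableOn.continuousOn_mul (MvPolynomial.continuous_eval P).continuousOn ?_ hcomp
  refine Integrable.const_mul ?_ _
  rw [restrict_cube]
  refine Integrable.fintype_prod_dep fun i => ?_
  have := intervalIntegrable_gegenbauerWeight (hlam i)
  rw [intervalIntegrable_iff_integrableOn_Icc_of_le (by norm_num)] at this
  exact this

/-- The products `∏ i, f_i(x_i)` of polynomials in one variable. -/
noncomputable def productPolynomial (f : Fin d → Polynomial ℝ) : MvPolynomial (Fin d) ℝ :=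
  ∏ i, (f i).toMvPolynomial i

lemma eval_productPolynomial (f : Fin d → Polynomial ℝ) (x : Fin d → ℝ) :
    MvPolynomial.eval x (productPolynomial f) = ∏ i, (f i).eval (x i) := by
  simp [productPolynomial, map_prod]

lemma weightInner_productPolynomial (hlam : ∀ i, -(1 / 2 : ℝ) < lam i)
    (f g : Fin d → Polynomial ℝ) :
    weightInner (cube d) (productWeight lam) (productPolynomial f) (productPolynomial g) =
      ∏ i, gegenbauerMean (hlam i) (f i * g i) := by
  rw [weightInner, restrict_cube]
  have e : ∀ x : Fin d → ℝ, MvPolynomial.eval x (productPolynomial f) *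
      MvPolynomial.eval x (productPolynomial g) * productWeight lam x =
      ∏ i, (gegenbauerConst (lam i) * ((f i * g i).eval (x i) *
        gegenbauerWeight (lam i) (x i))) := fun x => by
    rw [eval_productPolynomial, eval_productPolynomial, productWeight, ← Finset.prod_mul_distrib,
      ← Finset.prod_mul_distrib, ← Finset.prod_mul_distrib]
    refine Finset.prod_congr rfl fun i _ => ?_
    rw [Polynomial.eval_mul]; ring
  simp_rw [e]
  rw [integral_fintype_prod_eq_prod
    (fun i t => gegenbauerConst (lam i) * ((f i * g i).eval t * gegenbauerWeight (lam i) t))]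
  refine Finset.prod_congr rfl fun i _ => ?_
  rw [integral_const_mul, gegenbauerMean_apply, integral_Icc_eq_integral_Ioc,
    intervalIntegral.integral_of_le (by norm_num)]

/-- The orthogonal polynomials `∏ i, Z_(l_i)(x_i)`. -/
noncomputable def zonalProduct (lam : Fin d → ℝ) (l : Fin d →₀ ℕ) : MvPolynomial (Fin d) ℝ :=
  productPolynomial fun i => zonal (lam i) (l i)

/-- The squared norm of `zonalProduct lam l`. -/
noncomputable def zonalProductNormSq (lam : Fin d → ℝ) (l : Fin d →₀ ℕ) : ℝ :=
  ∏ i, (zonal (lam i) (l i)).eval 1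

lemma zonalProductNormSq_pos (hlam : ∀ i, -(1 / 2 : ℝ) < lam i) (l : Fin d →₀ ℕ) :
    0 < zonalProductNormSq lam l :=
  Finset.prod_pos fun i _ => PowerSeries.eval_one_zonal_pos (hlam i) (l i)

lemma weightInner_zonalProduct (hlam : ∀ i, -(1 / 2 : ℝ) < lam i) (l m : Fin d →₀ ℕ) :
    weightInner (cube d) (productWeight lam) (zonalProduct lam l) (zonalProduct lam m) =
      if l = m then zonalProductNormSq lam l else 0 := by
  rw [zonalProduct, zonalProduct, weightInner_productPolynomial hlam]
  simp only [gegenbauerMean_zonal_mul_zonal]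
  split_ifs with h
  · subst h; simp [zonalProductNormSq]
  · obtain ⟨i, hi⟩ : ∃ i, l i ≠ m i := by
      by_contra hc
      push Not at hc
      exact h (Finsupp.ext hc)
    exact Finset.prod_eq_zero (Finset.mem_univ i) (if_neg hi)

lemma totalDegree_toMvPolynomial_le (i : Fin d) (p : Polynomial ℝ) :
    (p.toMvPolynomial i).totalDegree ≤ p.natDegree := by
  conv_lhs => rw [p.as_sum_range_C_mul_X_pow]
  rw [map_sum]
  refine MvPolynomial.totalDegree_finsetSum_le fun k hk => ?_
  rw [map_mul, map_pow, Polynomial.toMvPolynomial_C, Polynomial.toMvPolynomial_X]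
  refine (MvPolynomial.totalDegree_mul _ _).trans ?_
  rw [MvPolynomial.totalDegree_C, zero_add]
  refine (MvPolynomial.totalDegree_X_pow _ _).le.trans ?_
  exact Nat.lt_succ_iff.1 (Finset.mem_range.1 hk)

lemma totalDegree_zonalProduct_le (hlam : ∀ i, -(1 / 2 : ℝ) < lam i) (l : Fin d →₀ ℕ) :
    (zonalProduct lam l).totalDegree ≤ ∑ i, l i := by
  refine (MvPolynomial.totalDegree_finsetProd _ _).trans (Finset.sum_le_sum fun i _ => ?_)
  refine (totalDegree_toMvPolynomial_le i _).trans ?_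
  exact Polynomial.natDegree_le_iff_degree_le.2
    (PowerSeries.degree_zonal (by linarith [hlam i]) (l i)).le

lemma mem_span_zonalProduct (hlam : ∀ i, -(1 / 2 : ℝ) < lam i) {n : ℕ}
    {Q : MvPolynomial (Fin d) ℝ} (hQ : Q.totalDegree ≤ n) :
    Q ∈ Submodule.span ℝ (zonalProduct lam '' {l | ∑ i, l i ≤ n}) := by
  rw [Q.as_sum]
  refine Submodule.sum_mem _ fun s hs => ?_
  have hsn : ∑ i, s i ≤ n := by
    refine le_trans ?_ hQ
    have := MvPolynomial.le_totalDegree hs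
    rwa [Finsupp.sum_fintype _ _ (by simp)] at this
  have hexp : ∀ i, ∃ c : ℕ → ℝ, (Polynomial.X : Polynomial ℝ) ^ s i =
      ∑ j ∈ Finset.range (s i + 1), c j • zonal (lam i) j := fun i => by
    have h1 := Polynomial.mem_span_of_degree_lt (n := s i + 1) (q := Polynomial.X ^ s i)
      (PowerSeries.degree_zonal (by linarith [hlam i] : -1 < lam i))
      (by rw [Polynomial.degree_X_pow]; exact_mod_cast Nat.lt_succ_self _)
    rw [← Finset.coe_range, Submodule.mem_span_image_finset_iff_exists_fun'] at h1
    obtain ⟨c, hc⟩ := h1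
    exact ⟨c, hc.symm⟩
  choose c hc using hexp
  have hmon : MvPolynomial.monomial s (Q.coeff s) =
      Q.coeff s • productPolynomial fun i => (Polynomial.X : Polynomial ℝ) ^ s i := by
    rw [MvPolynomial.monomial_eq, Finsupp.prod_fintype _ _ (by simp), MvPolynomial.smul_eq_C_mul,
      productPolynomial]
    simp
  rw [hmon]
  refine Submodule.smul_mem _ _ ?_
  simp only [productPolynomial, hc, map_sum, map_smul]
  rw [Finset.prod_univ_sum]
  refine Submodule.sum_mem _ fun l hl => ?_
  rw [Finset.prod_smul]
  refine Submodule.smul_mem _ _ (Submodule.subset_span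
    ⟨Finsupp.equivFunOnFinite.symm l, ?_, rfl⟩)
  refine le_trans (Finset.sum_le_sum fun i _ => ?_) hsn
  have := Fintype.mem_piFinset.1 hl i
  simpa using Nat.lt_succ_iff.1 (Finset.mem_range.1 this)

/-- By orthogonality the bilinear form picks out the coefficient of `zonalProduct lam l`. -/
lemma weightInner_linearCombination (hlam : ∀ i, -(1 / 2 : ℝ) < lam i)
    (a : (Fin d →₀ ℕ) →₀ ℝ) (l : Fin d →₀ ℕ) :
    weightInner (cube d) (productWeight lam)
      (Finsupp.linearCombination ℝ (zonalProduct lam) a) (zonalProduct lam l) =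
      a l * zonalProductNormSq lam l := by
  have e : ∀ x, MvPolynomial.eval x (Finsupp.linearCombination ℝ (zonalProduct lam) a) *
      MvPolynomial.eval x (zonalProduct lam l) * productWeight lam x =
      ∑ m ∈ a.support, a m * (MvPolynomial.eval x (zonalProduct lam m) *
      MvPolynomial.eval x (zonalProduct lam l) * productWeight lam x) := fun x => by
    rw [Finsupp.linearCombination_apply, Finsupp.sum, map_sum, Finset.sum_mul, Finset.sum_mul]
    refine Finset.sum_congr rfl fun m _ => ?_
    rw [MvPolynomial.smul_eval]; ring
  rw [weightInner]
  simp_rw [e]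
  rw [integral_finsetSum]
  · simp_rw [integral_const_mul]
    have := fun m => weightInner_zonalProduct hlam m l
    simp only [weightInner] at this
    simp_rw [this]
    rw [Finset.sum_eq_single l]
    · simp
    · intro m _ hm
      rw [if_neg hm, mul_zero]
    · intro hl
      rw [Finsupp.notMem_support_iff.1 hl, zero_mul]
  · intro m _
    have := integrableOn_eval_mul_productWeight hlam (zonalProduct lam m * zonalProduct lam l)
    simp only [map_mul] at this
    exact this.const_mul _

lemma mem_span_zonalProduct_of_mem_orthogonalPolynomials (hlam : ∀ i, -(1 / 2 : ℝ) < lam i)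
    {n : ℕ} {Q : MvPolynomial (Fin d) ℝ}
    (hQ : Q ∈ orthogonalPolynomials (cube d) (productWeight lam) n) :
    Q ∈ Submodule.span ℝ (zonalProduct lam '' {l | ∑ i, l i = n}) := by
  obtain ⟨a, ha, rfl⟩ := (Finsupp.mem_span_image_iff_linearCombination ℝ).1
    (mem_span_zonalProduct hlam hQ.1)
  refine (Finsupp.mem_span_image_iff_linearCombination ℝ).2 ⟨a, ?_, rfl⟩
  rw [Finsupp.mem_supported] at ha ⊢
  intro l hl
  refine le_antisymm (ha hl) (not_lt.1 fun hlt => ?_)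
  have h1 := hQ.2 (zonalProduct lam l) ((totalDegree_zonalProduct_le hlam l).trans_lt hlt)
  rw [weightInner_linearCombination hlam] at h1
  rcases mul_eq_zero.1 h1 with h2 | h2
  · exact (Finsupp.mem_support_iff.1 hl) h2
  · exact (zonalProductNormSq_pos hlam l).ne' h2

lemma weightInner_smul_smul {Ω : Set (Fin d → ℝ)} {W : (Fin d → ℝ) → ℝ} (a b : ℝ)
    (P Q : MvPolynomial (Fin d) ℝ) :
    weightInner Ω W (a • P) (b • Q) = a * b * weightInner Ω W P Q := by
  simp only [weightInner, MvPolynomial.smul_eval]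
  rw [← integral_const_mul]
  congr 1
  ext x
  ring

/-- The reproducing kernels of a product weight are the coefficients of the product of the
generating series of the reproducing kernels of its factors. -/
theorem isReproducingKernel_productWeight (hlam : ∀ i, -(1 / 2 : ℝ) < lam i) (n : ℕ) :
    IsReproducingKernel (cube d) (productWeight lam) n fun x y =>
      PowerSeries.coeff n (∏ i, zonalKernelSeries (lam i) (x i) (y i)) := by
  set S := Finset.finsuppAntidiag (Finset.univ : Finset (Fin d)) n with hS
  have hmemS : ∀ l : Fin d →₀ ℕ, l ∈ S ↔ ∑ i, l i = n := fun l => by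
    rw [hS, Finset.mem_finsuppAntidiag]
    simp
  set e := S.equivFin.symm with he
  have hN := fun l => zonalProductNormSq_pos hlam l
  set P : Fin S.card → MvPolynomial (Fin d) ℝ := fun j =>
    (√(zonalProductNormSq lam (e j)))⁻¹ • zonalProduct lam (e j) with hP
  refine ⟨S.card, P, ⟨fun j => ⟨?_, fun Q hQ => ?_⟩, fun j k => ?_, fun Q hQ => ?_⟩, fun x y => ?_⟩
  · refine (MvPolynomial.totalDegree_smul_le _ _).trans
      ((totalDegree_zonalProduct_le hlam _).trans ?_)
    exact ((hmemS _).1 (e j).2).le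
  · -- A polynomial of degree below `n` is a combination of products of lower degree.
    have hQ' : Q.totalDegree ≤ n - 1 := by omega
    obtain ⟨a, ha, rfl⟩ := (Finsupp.mem_span_image_iff_linearCombination ℝ).1
      (mem_span_zonalProduct hlam hQ')
    have h1 := weightInner_linearCombination hlam a (e j)
    have h0 : a (e j) = 0 := by
      by_contra h0
      have h2 : ∑ i, (e j : Fin d →₀ ℕ) i ≤ n - 1 :=
        (Finsupp.mem_supported ℝ a).1 ha (Finsupp.mem_support_iff.2 h0)
      have h3 := (hmemS _).1 (e j).2
      omega
    rw [h0, zero_mul] at h1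
    have h4 := weightInner_smul_smul (Ω := cube d) (W := productWeight lam)
      (√(zonalProductNormSq lam (e j)))⁻¹ 1 (zonalProduct lam (e j))
      (Finsupp.linearCombination ℝ (zonalProduct lam) a)
    rw [one_smul] at h4
    have h5 : weightInner (cube d) (productWeight lam) (zonalProduct lam (e j))
        (Finsupp.linearCombination ℝ (zonalProduct lam) a) = 0 := by
      rw [← h1]; simp only [weightInner, mul_comm]
    rw [h5, mul_zero] at h4
    exact h4
  · rw [hP, weightInner_smul_smul, weightInner_zonalProduct hlam]
    by_cases hjk : j = k
    · subst hjk
      rw [if_pos rfl, if_pos rfl, ← mul_inv, Real.mul_self_sqrt (hN _).le,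
        inv_mul_cancel₀ (hN _).ne']
    · rw [if_neg hjk, if_neg, mul_zero]
      exact fun h => hjk (e.injective (Subtype.ext h))
  · refine Submodule.span_le.2 ?_ (mem_span_zonalProduct_of_mem_orthogonalPolynomials hlam hQ)
    rintro _ ⟨l, hl, rfl⟩
    have h1 : zonalProduct lam l =
        √(zonalProductNormSq lam l) • P (e.symm ⟨l, (hmemS l).2 hl⟩) := by
      simp only [hP, Equiv.apply_symm_apply, smul_smul]
      rw [mul_inv_cancel₀ (Real.sqrt_pos.2 (hN l)).ne', one_smul]
    rw [h1]
    exact Submodule.smul_mem _ _ (Submodule.subset_span ⟨_, rfl⟩)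
  · beta_reduce
    rw [PowerSeries.coeff_prod]
    have h1 : ∀ l, ∏ i, PowerSeries.coeff (l i) (zonalKernelSeries (lam i) (x i) (y i)) =
        (zonalProductNormSq lam l)⁻¹ * (MvPolynomial.eval x (zonalProduct lam l) *
          MvPolynomial.eval y (zonalProduct lam l)) := fun l => by
      simp only [zonalKernelSeries, PowerSeries.coeff_mk, zonalKernel, zonalProduct,
        eval_productPolynomial, zonalProductNormSq, Finset.prod_div_distrib,
        Finset.prod_mul_distrib]
      ring
    rw [Finset.sum_congr rfl fun l _ => h1 l, ← Finset.sum_coe_sort, ← e.sum_comp]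
    refine Finset.sum_congr rfl fun j _ => ?_
    simp only [hP, MvPolynomial.smul_eval]
    have h2 : (zonalProductNormSq lam (e j))⁻¹ = (√(zonalProductNormSq lam (e j)))⁻¹ *
        (√(zonalProductNormSq lam (e j)))⁻¹ := by
      rw [← mul_inv, Real.mul_self_sqrt (hN _).le]
    rw [h2]
    ring

/-- Generating series of the Cesàro kernels of a product weight. -/
theorem cesaroKernel_eq (hlam : ∀ i, -(1 / 2 : ℝ) < lam i) (δ : ℝ) (n : ℕ) (x y : Fin d → ℝ) :
    cesaroKernel (cube d) (productWeight lam) δ n x y = 1 / Ring.choose ((n : ℝ) + δ) n *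
      PowerSeries.coeff n
        (negBinomial ℝ (δ + 1) * ∏ i, zonalKernelSeries (lam i) (x i) (y i)) := by
  have h1 : ∀ k, reproducingKernel (cube d) (productWeight lam) k x y =
      PowerSeries.coeff k (∏ i, zonalKernelSeries (lam i) (x i) (y i)) := fun k => by
    rw [reproducingKernel_eq (integrableOn_eval_mul_productWeight hlam)
      (isReproducingKernel_productWeight hlam k)]
  rw [cesaroKernel]
  simp_rw [h1]
  rw [sum_choose_mul_eq_coeff]
  congr 3
  ext k
  rw [PowerSeries.coeff_mk]

end Product

end ProductGegenbauer

/-! ### Dirichlet integrals over the simplex -/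

namespace ProductGegenbauer

/-- The solid simplex `{u ∈ ℝ^k : u_i ≥ 0, ∑ u_i ≤ 1}`, which parametrizes the standard simplex. -/
def solidSimplex (k : ℕ) : Set (Fin k → ℝ) := {u | (∀ i, 0 ≤ u i) ∧ ∑ i, u i ≤ 1}

lemma measurableSet_solidSimplex (k : ℕ) : MeasurableSet (solidSimplex k) := by
  refine IsClosed.measurableSet (IsClosed.inter (s₁ := {u : Fin k → ℝ | ∀ i, 0 ≤ u i})
    (s₂ := {u : Fin k → ℝ | ∑ i, u i ≤ 1}) ?_ ?_)
  · simp only [Set.ofPred_forall]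
    exact isClosed_iInter fun i => isClosed_le continuous_const (continuous_apply i)
  · exact isClosed_le (f := fun u : Fin k → ℝ => ∑ i, u i) (by fun_prop) continuous_const

/-- The parametrization `u ↦ (u_1, …, u_k, 1 - ∑ u_i)` of the standard simplex. -/
noncomputable def simplexPoint {k : ℕ} (u : Fin k → ℝ) : Fin (k + 1) → ℝ :=
  Fin.snoc u (1 - ∑ i, u i)

lemma measurable_simplexPoint (k : ℕ) : Measurable (simplexPoint (k := k)) := by
  refine measurable_pi_lambda _ fun i => ?_
  refine Fin.lastCases ?_ (fun j => ?_) i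
  · simp only [simplexPoint, Fin.snoc_last]; fun_prop
  · simp only [simplexPoint, Fin.snoc_castSucc]; fun_prop

lemma simplexMeasure_succ (k : ℕ) :
    simplexMeasure (k + 1) = Measure.map simplexPoint (volume.restrict (solidSimplex k)) := rfl

lemma lintegral_simplexMeasure {k : ℕ} {F : (Fin (k + 1) → ℝ) → ENNReal} (hF : Measurable F) :
    ∫⁻ y, F y ∂simplexMeasure (k + 1) =
      ∫⁻ u, (solidSimplex k).indicator (fun u => F (simplexPoint u)) u := by
  rw [simplexMeasure_succ, lintegral_map hF (measurable_simplexPoint k),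
    lintegral_indicator (measurableSet_solidSimplex k)]

lemma ae_simplexMeasure (k : ℕ) :
    ∀ᵐ y ∂simplexMeasure (k + 1), (∀ i, 0 ≤ y i) ∧ ∑ i, y i = 1 := by
  have hm : MeasurableSet {y : Fin (k + 1) → ℝ | (∀ i, 0 ≤ y i) ∧ ∑ i, y i = 1} := by
    refine IsClosed.measurableSet (IsClosed.inter (s₁ := {u : Fin (k + 1) → ℝ | ∀ i, 0 ≤ u i})
      (s₂ := {u : Fin (k + 1) → ℝ | ∑ i, u i = 1}) ?_ ?_)
    · simp only [Set.ofPred_forall]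
      exact isClosed_iInter fun i => isClosed_le continuous_const (continuous_apply i)
    · exact isClosed_eq (f := fun u : Fin (k + 1) → ℝ => ∑ i, u i) (by fun_prop) continuous_const
  rw [simplexMeasure_succ, ae_map_iff (measurable_simplexPoint k).aemeasurable hm]
  refine ae_restrict_of_forall_mem (measurableSet_solidSimplex k) fun u hu => ⟨fun i => ?_, ?_⟩
  · refine Fin.lastCases ?_ (fun j => ?_) i
    · simp only [simplexPoint, Fin.snoc_last]; linarith [hu.2]
    · simpa only [simplexPoint, Fin.snoc_castSucc] using hu.1 j
  · rw [Fin.sum_univ_castSucc]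
    simp [simplexPoint]

lemma lintegral_comp_smul {k : ℕ} (g : (Fin k → ℝ) → ENNReal) (hg : Measurable g) {c : ℝ}
    (hc : 0 < c) :
    ∫⁻ w, g w = ENNReal.ofReal (c ^ k) * ∫⁻ w, g (c • w) := by
  have h1 := Measure.map_addHaar_smul (volume : Measure (Fin k → ℝ)) hc.ne'
  have h2 : ∫⁻ w, g (c • w) = ∫⁻ w, g w ∂(Measure.map (c • ·) volume) :=
    (lintegral_map hg (measurable_const_smul c)).symm
  rw [h2, h1, lintegral_smul_measure, Module.finrank_fin_fun, smul_eq_mul, ← mul_assoc,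
    ← ENNReal.ofReal_mul (by positivity), abs_of_pos (by positivity),
    mul_inv_cancel₀ (by positivity), ENNReal.ofReal_one, one_mul]

/-- Peeling off the first barycentric coordinate `s` of a point of the simplex. -/
lemma lintegral_simplexMeasure_succ {k : ℕ} {F : (Fin (k + 2) → ℝ) → ENNReal}
    (hF : Measurable F) :
    ∫⁻ y, F y ∂simplexMeasure (k + 2) =
      ∫⁻ s in Set.Ioo (0 : ℝ) 1, ENNReal.ofReal ((1 - s) ^ k) *
        ∫⁻ y, F (Fin.cons s ((1 - s) • y)) ∂simplexMeasure (k + 1) := by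
  rw [lintegral_simplexMeasure hF]
  set G := (solidSimplex (k + 1)).indicator (fun u => F (simplexPoint u)) with hG
  have hGm : Measurable G :=
    (hF.comp (measurable_simplexPoint _)).indicator (measurableSet_solidSimplex _)
  have hmp := (volume_preserving_piFinSuccAbove (fun _ : Fin (k + 1) => ℝ) 0).symm
  rw [← hmp.lintegral_comp hGm]
  have hcons : ∀ z : ℝ × (Fin k → ℝ),
      (MeasurableEquiv.piFinSuccAbove (fun _ : Fin (k + 1) => ℝ) 0).symm z = Fin.cons z.1 z.2 :=
    fun z => by
      change Fin.insertNth (α := fun _ => ℝ) 0 z.1 z.2 = _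
      rw [Fin.insertNth_zero']
  simp_rw [hcons]
  have hcm : Measurable fun z : ℝ × (Fin k → ℝ) => (Fin.cons z.1 z.2 : Fin (k + 1) → ℝ) := by
    refine measurable_pi_lambda _ fun i => ?_
    refine Fin.cases ?_ (fun j => ?_) i
    · simp only [Fin.cons_zero]; fun_prop
    · simp only [Fin.cons_succ]; fun_prop
  change ∫⁻ z, G (Fin.cons z.1 z.2) ∂(volume.prod volume) = _
  rw [lintegral_prod (fun z : ℝ × (Fin k → ℝ) => G (Fin.cons z.1 z.2))
    (hGm.comp hcm).aemeasurable, ← lintegral_indicator measurableSet_Ioo]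
  refine lintegral_congr_ae ?_
  -- The end points are discarded because the slice at `s = 1` cannot be rescaled.
  have h0 : ∀ᵐ s : ℝ, s ≠ 0 := Measure.ae_ne volume 0
  have h1 : ∀ᵐ s : ℝ, s ≠ 1 := Measure.ae_ne volume 1
  filter_upwards [h0, h1] with s hs0 hs1
  by_cases hs : s ∈ Set.Ioo (0 : ℝ) 1
  · rw [Set.indicator_of_mem hs]
    have hc : 0 < 1 - s := by linarith [hs.2]
    have hgm : Measurable fun w : Fin k → ℝ => G (Fin.cons s w) :=
      hGm.comp (hcm.comp measurable_prodMk_left)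
    have hFm : Measurable fun y : Fin (k + 1) → ℝ => F (Fin.cons s ((1 - s) • y)) := by
      refine hF.comp (measurable_pi_lambda _ fun i => ?_)
      refine Fin.cases ?_ (fun j => ?_) i
      · simp only [Fin.cons_zero]; fun_prop
      · simp only [Fin.cons_succ, Pi.smul_apply]; fun_prop
    rw [lintegral_comp_smul _ hgm hc, lintegral_simplexMeasure hFm]
    congr 2
    ext w
    have hmem : (Fin.cons s ((1 - s) • w) : Fin (k + 1) → ℝ) ∈ solidSimplex (k + 1) ↔
        w ∈ solidSimplex k := by
      simp only [solidSimplex, Set.mem_ofPred_eq, Fin.forall_fin_succ, Fin.cons_zero,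
        Fin.cons_succ, Fin.sum_univ_succ, Pi.smul_apply, smul_eq_mul, ← Finset.mul_sum]
      constructor
      · rintro ⟨⟨-, h2⟩, h3⟩
        exact ⟨fun i => nonneg_of_mul_nonneg_right (h2 i) hc,
          le_of_mul_le_mul_left (by linarith) hc⟩
      · rintro ⟨h2, h3⟩
        exact ⟨⟨hs.1.le, fun i => mul_nonneg hc.le (h2 i)⟩, by nlinarith⟩
    have hpt : simplexPoint (Fin.cons s ((1 - s) • w) : Fin (k + 1) → ℝ) =
        Fin.cons s ((1 - s) • simplexPoint w) := by
      rw [simplexPoint, ← Fin.cons_snoc_eq_snoc_cons]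
      congr 1
      ext i
      refine Fin.lastCases ?_ (fun j => ?_) i
      · simp only [Fin.snoc_last, simplexPoint, Fin.sum_univ_succ, Fin.cons_zero, Fin.cons_succ,
          Pi.smul_apply, smul_eq_mul, ← Finset.mul_sum]
        ring
      · simp [simplexPoint]
    by_cases hw : w ∈ solidSimplex k
    · rw [hG, Set.indicator_of_mem (hmem.2 hw), Set.indicator_of_mem hw, hpt]
    · rw [hG, Set.indicator_of_notMem (mt hmem.1 hw), Set.indicator_of_notMem hw]
  · rw [Set.indicator_of_notMem hs]
    have : ∀ w : Fin k → ℝ, G (Fin.cons s w) = 0 := fun w => by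
      refine Set.indicator_of_notMem (fun hw => hs ?_) _
      have h2 : 0 ≤ s := by simpa using hw.1 0
      have h3 : s + ∑ i, w i ≤ 1 := by simpa [Fin.sum_univ_succ] using hw.2
      have h4 : 0 ≤ ∑ i, w i := Finset.sum_nonneg fun i _ => by simpa using hw.1 i.succ
      exact ⟨lt_of_le_of_ne h2 hs0.symm, lt_of_le_of_ne (by linarith) hs1⟩
    simp [this]

lemma lintegral_rpow_mul_one_sub_rpow {a b : ℝ} (ha : 0 < a) (hb : 0 < b) :
    ∫⁻ s in Set.Ioo (0 : ℝ) 1, ENNReal.ofReal (s ^ (a - 1) * (1 - s) ^ (b - 1)) =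
      ENNReal.ofReal (Real.Gamma a * Real.Gamma b / Real.Gamma (a + b)) := by
  have h := ProbabilityTheory.lintegral_betaPDF_eq_one ha hb
  have hpos := ProbabilityTheory.beta_pos ha hb
  rw [ProbabilityTheory.lintegral_betaPDF] at h
  simp_rw [mul_assoc, ENNReal.ofReal_mul (one_div_nonneg.2 hpos.le)] at h
  rw [lintegral_const_mul _ (by fun_prop)] at h
  calc _ = ENNReal.ofReal (ProbabilityTheory.beta a b) *
        (ENNReal.ofReal (1 / ProbabilityTheory.beta a b) *
        ∫⁻ s in Set.Ioo (0 : ℝ) 1, ENNReal.ofReal (s ^ (a - 1) * (1 - s) ^ (b - 1))) := by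
        rw [← mul_assoc, ← ENNReal.ofReal_mul hpos.le, mul_one_div_cancel hpos.ne',
          ENNReal.ofReal_one, one_mul]
    _ = _ := by rw [h, mul_one]; rfl

/-- Dirichlet's integral, by induction on the dimension: peeling off one coordinate leaves a beta
integral. -/
theorem lintegral_dirichlet {k : ℕ} {b : Fin (k + 1) → ℝ} (hb : ∀ i, 0 < b i) :
    ∫⁻ y, ENNReal.ofReal (∏ i, y i ^ (b i - 1)) ∂simplexMeasure (k + 1) =
      ENNReal.ofReal ((∏ i, Real.Gamma (b i)) / Real.Gamma (∑ i, b i)) := by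
  induction k with
  | zero =>
    rw [lintegral_simplexMeasure (by fun_prop)]
    have h0 : ∀ u : Fin 0 → ℝ, u ∈ solidSimplex 0 := fun u => by simp [solidSimplex]
    simp only [Set.indicator_of_mem (h0 _)]
    rw [lintegral_unique]
    have : Real.Gamma (b 0) ≠ 0 := (Real.Gamma_pos_of_pos (hb 0)).ne'
    simp [simplexPoint, Fin.snoc, this, volume_pi]
  | succ k ih =>
    set b' : Fin (k + 1) → ℝ := fun i => b i.succ with hb'
    set B := ∑ i, b' i with hB
    have hBpos : 0 < B := Finset.sum_pos (fun i _ => hb _) Finset.univ_nonempty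
    have ih' := ih (b := b') fun i => hb _
    rw [lintegral_simplexMeasure_succ (by fun_prop)]
    have hinner : ∀ s ∈ Set.Ioo (0 : ℝ) 1, ENNReal.ofReal ((1 - s) ^ k) *
        ∫⁻ y, ENNReal.ofReal (∏ i, (Fin.cons s ((1 - s) • y) : Fin (k + 2) → ℝ) i ^ (b i - 1))
          ∂simplexMeasure (k + 1) =
        ENNReal.ofReal (s ^ (b 0 - 1) * (1 - s) ^ (B - 1)) *
          ENNReal.ofReal ((∏ i, Real.Gamma (b' i)) / Real.Gamma B) := by
      intro s hs
      have hc : 0 < 1 - s := by linarith [hs.2]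
      have e : ∀ᵐ y ∂simplexMeasure (k + 1),
          ENNReal.ofReal (∏ i, (Fin.cons s ((1 - s) • y) : Fin (k + 2) → ℝ) i ^ (b i - 1)) =
          ENNReal.ofReal (s ^ (b 0 - 1) * (1 - s) ^ (B - (k + 1))) *
            ENNReal.ofReal (∏ i, y i ^ (b' i - 1)) := by
        filter_upwards [ae_simplexMeasure k] with y hy
        rw [← ENNReal.ofReal_mul
          (mul_nonneg (Real.rpow_nonneg hs.1.le _) (Real.rpow_nonneg hc.le _)), Fin.prod_univ_succ]
        congr 1
        simp only [Fin.cons_zero, Fin.cons_succ, Pi.smul_apply, smul_eq_mul]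
        rw [Finset.prod_congr rfl fun i _ => Real.mul_rpow hc.le (hy.1 i),
          Finset.prod_mul_distrib, ← Real.rpow_sum_of_pos hc, Finset.sum_sub_distrib]
        simp only [Finset.sum_const, Finset.card_univ, Fintype.card_fin, nsmul_eq_mul, mul_one]
        push_cast
        rw [mul_assoc]
      rw [lintegral_congr_ae e, lintegral_const_mul _ (by fun_prop), ih', ← mul_assoc,
        ← ENNReal.ofReal_mul (by positivity)]
      congr 2
      have : (1 - s) ^ (B - 1) = (1 - s) ^ k * (1 - s) ^ (B - (k + 1)) := by
        rw [← Real.rpow_natCast, ← Real.rpow_add hc]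
        ring_nf
      rw [this]
      ring
    rw [setLIntegral_congr_fun measurableSet_Ioo hinner, lintegral_mul_const _ (by fun_prop),
      lintegral_rpow_mul_one_sub_rpow (hb 0) hBpos, ← ENNReal.ofReal_mul]
    · congr 1
      rw [Fin.prod_univ_succ (fun i => Real.Gamma (b i)), Fin.sum_univ_succ b]
      have := (Real.Gamma_pos_of_pos hBpos).ne'
      change _ = Real.Gamma (b 0) * (∏ i, Real.Gamma (b' i)) / Real.Gamma (b 0 + B)
      field_simp
    · have h1 := Real.Gamma_pos_of_pos hBpos
      have h2 := Real.Gamma_pos_of_pos (hb 0)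
      have h3 := Real.Gamma_pos_of_pos (add_pos (hb 0) hBpos)
      positivity

end ProductGegenbauer

/-! ### The Liouville–Feynman formula for products of generating functions -/

namespace ProductGegenbauer

lemma gamma_add_natCast {ν : ℝ} (hν : 0 < ν) (j : ℕ) :
    Real.Gamma (ν + j) = Real.Gamma ν * j.factorial * Ring.choose (ν + j - 1) j := by
  induction j with
  | zero => simp
  | succ j ih =>
    have h := PowerSeries.succ_mul_choose_add ν j
    rw [Nat.cast_succ, ← add_assoc, Real.Gamma_add_one (by positivity), ih, Nat.factorial_succ]
    push_cast at h ⊢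
    rw [← add_assoc] at h
    linear_combination -(Real.Gamma ν * (j.factorial : ℝ)) * h

lemma pow_mul_rpow {y l : ℝ} (hy : 0 ≤ y) (hl : -(1 / 2 : ℝ) < l) (j : ℕ) :
    y ^ j * y ^ l = y ^ (l + 1 + j - 1) := by
  rcases Nat.eq_zero_or_pos j with rfl | hj
  · simp
  · -- The exponent `l + j` is nonzero, so that the identity persists at `y = 0`.
    have hj' : (1 : ℝ) ≤ j := by exact_mod_cast hj
    rw [show l + 1 + j - 1 = l + j by ring, Real.rpow_add' hy (by linarith : l + (j : ℝ) ≠ 0),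
      Real.rpow_natCast, mul_comm]

section

variable {k : ℕ} {lam : Fin (k + 1) → ℝ}

lemma ae_monomial_mul_rpow (hlam : ∀ i, -(1 / 2 : ℝ) < lam i) (l : Fin (k + 1) → ℕ) :
    (fun y : Fin (k + 1) → ℝ => (∏ i, y i ^ l i) * ∏ i, y i ^ lam i) =ᵐ[simplexMeasure (k + 1)]
      fun y => ∏ i, y i ^ (lam i + 1 + l i - 1) := by
  filter_upwards [ae_simplexMeasure k] with y hy
  rw [← Finset.prod_mul_distrib]
  exact Finset.prod_congr rfl fun i _ => pow_mul_rpow (hy.1 i) (hlam i) (l i)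

lemma integrable_monomial_mul_rpow (hlam : ∀ i, -(1 / 2 : ℝ) < lam i) (l : Fin (k + 1) → ℕ) :
    Integrable (fun y : Fin (k + 1) → ℝ => (∏ i, y i ^ l i) * ∏ i, y i ^ lam i)
      (simplexMeasure (k + 1)) := by
  refine Integrable.congr ?_ (ae_monomial_mul_rpow hlam l).symm
  refine ⟨Measurable.aestronglyMeasurable (by fun_prop), ?_⟩
  rw [hasFiniteIntegral_iff_ofReal, lintegral_dirichlet]
  · exact ENNReal.ofReal_lt_top
  · intro i
    have := hlam i
    have h2 : (0 : ℝ) ≤ l i := Nat.cast_nonneg _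
    linarith
  · filter_upwards [ae_simplexMeasure k] with y hy
    exact Finset.prod_nonneg fun i _ => Real.rpow_nonneg (hy.1 i) _

lemma integral_monomial_mul_rpow (hlam : ∀ i, -(1 / 2 : ℝ) < lam i) (l : Fin (k + 1) → ℕ) :
    ∫ y, (∏ i, y i ^ l i) * ∏ i, y i ^ lam i ∂simplexMeasure (k + 1) =
      (∏ i, Real.Gamma (lam i + 1 + l i)) / Real.Gamma (∑ i, (lam i + 1 + l i)) := by
  have hb : ∀ i, 0 < lam i + 1 + l i := fun i => by
    have := hlam i
    have h2 : (0 : ℝ) ≤ l i := Nat.cast_nonneg _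
    linarith
  rw [integral_congr_ae (ae_monomial_mul_rpow hlam l), integral_eq_lintegral_of_nonneg_ae,
    lintegral_dirichlet hb, ENNReal.toReal_ofReal]
  · exact div_nonneg (Finset.prod_nonneg fun i _ => (Real.Gamma_pos_of_pos (hb i)).le)
      (Real.Gamma_pos_of_pos (Finset.sum_pos (fun i _ => hb i) Finset.univ_nonempty)).le
  · filter_upwards [ae_simplexMeasure k] with y hy
    exact Finset.prod_nonneg fun i _ => Real.rpow_nonneg (hy.1 i) _
  · exact Measurable.aestronglyMeasurable (by fun_prop)

/-- The multinomial weights turn the moments of the Dirichlet distribution into products of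
binomial coefficients. -/
lemma choose_mul_multinomial_mul_integral (hlam : ∀ i, -(1 / 2 : ℝ) < lam i)
    (l : Fin (k + 1) → ℕ) :
    Ring.choose (∑ i, (lam i + 1) + (∑ i, l i : ℕ) - 1) (∑ i, l i) *
      Nat.multinomial Finset.univ l * (sigmaConst (fun i => lam i + 1) *
        ∫ y, (∏ i, y i ^ l i) * ∏ i, y i ^ lam i ∂simplexMeasure (k + 1)) =
      ∏ i, Ring.choose (lam i + 1 + l i - 1) (l i) := by
  have ha : ∀ i, 0 < lam i + 1 := fun i => by linarith [hlam i]
  have hA : 0 < ∑ i, (lam i + 1) := Finset.sum_pos (fun i _ => ha i) Finset.univ_nonempty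
  have hC := PowerSeries.choose_add_pos hA (∑ i, l i)
  have hm : ((∏ i, (l i).factorial : ℕ) : ℝ) * Nat.multinomial Finset.univ l =
      (∑ i, l i).factorial := by
    exact_mod_cast Nat.multinomial_spec Finset.univ l
  push_cast at hm
  have hs : ∑ i, (lam i + 1 + l i) = ∑ i, (lam i + 1) + (∑ i, l i : ℕ) := by
    rw [Finset.sum_add_distrib, ← Nat.cast_sum]
  rw [integral_monomial_mul_rpow hlam, sigmaConst, hs,
    gamma_add_natCast hA, Finset.prod_congr rfl fun i _ => gamma_add_natCast (ha i) (l i),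
    Finset.prod_mul_distrib, Finset.prod_mul_distrib, ← hm]
  have h1 := (Real.Gamma_pos_of_pos hA).ne'
  have h2 : (∏ i, Real.Gamma (lam i + 1)) ≠ 0 :=
    Finset.prod_ne_zero_iff.2 fun i _ => (Real.Gamma_pos_of_pos (ha i)).ne'
  have h3 : (∏ i, ((l i).factorial : ℝ)) ≠ 0 :=
    Finset.prod_ne_zero_iff.2 fun i _ => by positivity
  have h4 : (Nat.multinomial Finset.univ l : ℝ) ≠ 0 := fun h => by
    rw [h, mul_zero] at hm
    exact (Nat.cast_ne_zero.2 (Nat.factorial_ne_zero _)) hm.symm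
  have h5 := hC.ne'
  field_simp

end

end ProductGegenbauer

namespace PowerSeries

/-- The series `u = X (2 a - X)`, for which `1 - u = 1 - 2 a X + X ^ 2`. -/
noncomputable def quadratic (a : ℝ) : ℝ⟦X⟧ := X * (2 * C a - X)

lemma coeff_quadratic_prod_pow_eq_zero {ι : Type*} [Fintype ι] {n : ℕ} {l : ι → ℕ} (x : ι → ℝ)
    (h : n < ∑ i, l i) : coeff n (∏ i, quadratic (x i) ^ l i) = 0 := by
  have h1 : (X : ℝ⟦X⟧) ^ (∑ i, l i) ∣ ∏ i, quadratic (x i) ^ l i := by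
    rw [← Finset.prod_pow_eq_pow_sum]
    exact Finset.prod_dvd_prod_of_dvd _ _ fun i _ =>
      pow_dvd_pow_of_dvd (Dvd.intro _ rfl) _
  exact X_pow_dvd_iff.1 h1 n h

lemma coeff_gegenbauerSeries_of_le (ν a : ℝ) {m n : ℕ} (h : m ≤ n) :
    coeff m (gegenbauerSeries ν a) =
      coeff m (∑ j ∈ Finset.range (n + 1), Ring.choose (ν + j - 1) j • quadratic a ^ j) := by
  rw [gegenbauerSeries, coeff_subst' (hasSubst_quadratic a), map_sum,
    finsum_eq_sum_of_support_subset (s := Finset.range (n + 1))]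
  · simp only [coeff_negBinomial, Algebra.algebraMap_self, RingHom.id_apply, map_smul]
    rfl
  · intro j hj
    rw [Finset.coe_range, Set.mem_Iio]
    by_contra hjn
    refine hj ?_
    have := coeff_quadratic_prod_pow_eq_zero (ι := Unit) (l := fun _ => j) (n := m) (fun _ => a)
      (by simpa using by omega)
    rw [Finset.univ_unique, Finset.prod_singleton] at this
    change _ • coeff m (quadratic a ^ j) = 0
    rw [this, smul_zero]

/-- Binomial expansion of a product of generating functions; multi-indices of total degree above
`n` do not contribute to the `n`-th coefficient. -/
lemma coeff_prod_gegenbauerSeries {ι : Type*} [Fintype ι] [DecidableEq ι] (a x : ι → ℝ) (n : ℕ) :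
    coeff n (∏ i, gegenbauerSeries (a i) (x i)) =
      ∑ j ∈ Finset.range (n + 1), ∑ l ∈ Finset.piAntidiag Finset.univ j,
        (∏ i, Ring.choose (a i + l i - 1) (l i)) * coeff n (∏ i, quadratic (x i) ^ l i) := by
  have h1 : coeff n (∏ i, gegenbauerSeries (a i) (x i)) = coeff n (∏ i,
      ∑ j ∈ Finset.range (n + 1), Ring.choose (a i + j - 1) j • quadratic (x i) ^ j) := by
    rw [coeff_prod, coeff_prod]
    refine Finset.sum_congr rfl fun l hl => Finset.prod_congr rfl fun i _ =>
      coeff_gegenbauerSeries_of_le _ _ ?_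
    rw [Finset.mem_finsuppAntidiag] at hl
    rw [← hl.1]
    exact Finset.single_le_sum (f := fun i => l i) (fun _ _ => Nat.zero_le _) (Finset.mem_univ i)
  rw [h1, Finset.prod_univ_sum, map_sum]
  have h2 : ∀ l : ι → ℕ,
      coeff n (∏ i, Ring.choose (a i + l i - 1) (l i) • quadratic (x i) ^ l i) =
      (∏ i, Ring.choose (a i + l i - 1) (l i)) * coeff n (∏ i, quadratic (x i) ^ l i) := fun l => by
    rw [Finset.prod_smul, map_smul, smul_eq_mul]
  simp_rw [h2]
  rw [← Finset.sum_filter_of_ne (p := fun l : ι → ℕ => ∑ i, l i ≤ n)]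
  · rw [← Finset.sum_fiberwise_of_maps_to (t := Finset.range (n + 1)) (g := fun l => ∑ i, l i)]
    · refine Finset.sum_congr rfl fun j hj => Finset.sum_congr ?_ fun _ _ => rfl
      ext l
      rw [Finset.mem_range] at hj
      simp only [Finset.mem_filter, Fintype.mem_piFinset, Finset.mem_range, Finset.mem_piAntidiag,
        Finset.mem_univ, implies_true, and_true]
      refine ⟨fun h => h.2, fun (h : ∑ i, l i = j) => ⟨⟨fun i => ?_, by omega⟩, h⟩⟩
      have := Finset.single_le_sum (f := l) (fun _ _ => Nat.zero_le _) (Finset.mem_univ i)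
      omega
    · intro l hl
      rw [Finset.mem_range]
      have := (Finset.mem_filter.1 hl).2
      omega
  · intro l _ hl
    by_contra h
    exact hl (by rw [coeff_quadratic_prod_pow_eq_zero x (not_le.1 h), mul_zero])

/-- On the simplex the quadratic series is affine in the point, so that its powers expand by the
multinomial theorem. -/
lemma coeff_gegenbauerSeries_sum_mul {ι : Type*} [Fintype ι] [DecidableEq ι] (ν : ℝ) (x : ι → ℝ)
    {y : ι → ℝ} (hy : ∑ i, y i = 1) (n : ℕ) :
    coeff n (gegenbauerSeries ν (∑ i, x i * y i)) =
      ∑ j ∈ Finset.range (n + 1), ∑ l ∈ Finset.piAntidiag Finset.univ j,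
        Ring.choose (ν + j - 1) j * Nat.multinomial Finset.univ l *
          coeff n (∏ i, quadratic (x i) ^ l i) * ∏ i, y i ^ l i := by
  have h1 : quadratic (∑ i, x i * y i) = ∑ i, y i • quadratic (x i) := by
    have h3 : ∀ i, y i • quadratic (x i) = 2 * X * C (x i * y i) - C (y i) * X ^ 2 := fun i => by
      rw [smul_eq_C_mul, quadratic, map_mul]; ring
    rw [Finset.sum_congr rfl fun i _ => h3 i, Finset.sum_sub_distrib, ← Finset.mul_sum,
      ← Finset.sum_mul, ← map_sum, ← map_sum, hy, quadratic, map_one]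
    ring
  rw [coeff_gegenbauerSeries_of_le ν _ le_rfl, map_sum, h1]
  refine Finset.sum_congr rfl fun j _ => ?_
  rw [Finset.sum_pow_eq_sum_piAntidiag, map_smul, map_sum, smul_eq_mul, Finset.mul_sum]
  refine Finset.sum_congr rfl fun l _ => ?_
  simp_rw [_root_.smul_pow]
  rw [Finset.prod_smul, ← nsmul_eq_mul, map_nsmul, map_smul, nsmul_eq_mul, smul_eq_mul]
  ring

end PowerSeries

namespace ProductGegenbauer

open PowerSeries (coeff quadratic)

variable {k : ℕ} {lam : Fin (k + 1) → ℝ}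

lemma ae_coeff_gegenbauerSeries_mul (ν : ℝ) (x : Fin (k + 1) → ℝ) (n : ℕ) :
    (fun y : Fin (k + 1) → ℝ =>
      coeff n (gegenbauerSeries ν (∑ i, x i * y i)) * ∏ i, y i ^ lam i)
      =ᵐ[simplexMeasure (k + 1)] fun y =>
      ∑ j ∈ Finset.range (n + 1), ∑ l ∈ Finset.piAntidiag Finset.univ j,
        Ring.choose (ν + j - 1) j * Nat.multinomial Finset.univ l *
          coeff n (∏ i, quadratic (x i) ^ l i) * ((∏ i, y i ^ l i) * ∏ i, y i ^ lam i) := by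
  filter_upwards [ae_simplexMeasure k] with y hy
  rw [PowerSeries.coeff_gegenbauerSeries_sum_mul ν x hy.2, Finset.sum_mul]
  refine Finset.sum_congr rfl fun j _ => ?_
  rw [Finset.sum_mul]
  exact Finset.sum_congr rfl fun l _ => mul_assoc _ _ _

lemma integrable_coeff_gegenbauerSeries_mul (hlam : ∀ i, -(1 / 2 : ℝ) < lam i) (ν : ℝ)
    (x : Fin (k + 1) → ℝ) (n : ℕ) :
    Integrable (fun y : Fin (k + 1) → ℝ =>
      coeff n (gegenbauerSeries ν (∑ i, x i * y i)) * ∏ i, y i ^ lam i)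
      (simplexMeasure (k + 1)) := by
  refine Integrable.congr ?_ (ae_coeff_gegenbauerSeries_mul ν x n).symm
  exact integrable_finsetSum _ fun j _ => integrable_finsetSum _ fun l _ =>
    (integrable_monomial_mul_rpow hlam l).const_mul _

/-- The coefficients of `∏ (1 - 2 x_i X + X^2)^(-a_i)` are the Dirichlet averages of those of
`(1 - 2 ⟨x, y⟩ X + X^2)^(-|a|)`. -/
theorem coeff_prod_gegenbauerSeries_eq_integral (hlam : ∀ i, -(1 / 2 : ℝ) < lam i)
    (x : Fin (k + 1) → ℝ) (n : ℕ) :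
    coeff n (∏ i, gegenbauerSeries (lam i + 1) (x i)) =
      sigmaConst (fun i => lam i + 1) *
        ∫ y, coeff n (gegenbauerSeries (∑ i, (lam i + 1)) (∑ i, x i * y i)) * ∏ i, y i ^ lam i
          ∂simplexMeasure (k + 1) := by
  rw [integral_congr_ae (ae_coeff_gegenbauerSeries_mul _ x n), integral_finsetSum]
  · rw [PowerSeries.coeff_prod_gegenbauerSeries, Finset.mul_sum]
    refine Finset.sum_congr rfl fun j _ => ?_
    rw [integral_finsetSum, Finset.mul_sum]
    · refine Finset.sum_congr rfl fun l hl => ?_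
      obtain rfl : ∑ i, l i = j := (Finset.mem_piAntidiag.1 hl).1
      rw [integral_const_mul, ← choose_mul_multinomial_mul_integral hlam l]
      ring
    · exact fun l _ => (integrable_monomial_mul_rpow hlam l).const_mul _
  · exact fun j _ => integrable_finsetSum _ fun l _ =>
      (integrable_monomial_mul_rpow hlam l).const_mul _

end ProductGegenbauer

/-! ### Comparison of the two Cesàro kernels -/

namespace PowerSeries

lemma coeff_one_add_X_pow_mul (k n : ℕ) (f : ℝ⟦X⟧) :
    coeff n ((1 + X) ^ k * f) =
      ∑ m ∈ Finset.range (min n k + 1), (k.choose m : ℝ) * coeff (n - m) f := by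
  have h1 : ∀ m, coeff m ((1 + X : ℝ⟦X⟧) ^ k) = k.choose m := fun m => by
    have := Polynomial.coeff_one_add_X_pow ℝ k m
    rw [← this, ← Polynomial.coeff_coe]
    simp
  rw [coeff_mul, Finset.Nat.sum_antidiagonal_eq_sum_range_succ_mk]
  simp_rw [h1]
  refine (Finset.sum_subset (fun m hm => ?_) fun m hm hm' => ?_).symm
  · rw [Finset.mem_range] at hm ⊢
    omega
  · rw [Finset.mem_range] at hm hm'
    rw [Nat.choose_eq_zero_of_lt (by omega), Nat.cast_zero, zero_mul]

end PowerSeries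

namespace ProductGegenbauer

open PowerSeries (coeff CoeffNonneg X)

section

variable {k : ℕ} {lam : Fin (k + 1) → ℝ}

lemma coeff_mul_gegenbauerSeries_mul (F : PowerSeries ℝ) (ν : ℝ) (x : Fin (k + 1) → ℝ) (n : ℕ) :
    (fun y : Fin (k + 1) → ℝ =>
      coeff n (F * gegenbauerSeries ν (∑ i, x i * y i)) * ∏ i, y i ^ lam i) =
    fun y => ∑ p ∈ Finset.HasAntidiagonal.antidiagonal n, coeff p.1 F *
      (coeff p.2 (gegenbauerSeries ν (∑ i, x i * y i)) * ∏ i, y i ^ lam i) := by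
  ext y
  rw [PowerSeries.coeff_mul, Finset.sum_mul]
  exact Finset.sum_congr rfl fun p _ => mul_assoc _ _ _

lemma integrable_coeff_mul_gegenbauerSeries_mul (hlam : ∀ i, -(1 / 2 : ℝ) < lam i)
    (F : PowerSeries ℝ) (ν : ℝ) (x : Fin (k + 1) → ℝ) (n : ℕ) :
    Integrable (fun y : Fin (k + 1) → ℝ =>
      coeff n (F * gegenbauerSeries ν (∑ i, x i * y i)) * ∏ i, y i ^ lam i)
      (simplexMeasure (k + 1)) := by
  rw [coeff_mul_gegenbauerSeries_mul]
  exact integrable_finsetSum _ fun p _ =>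
    (integrable_coeff_gegenbauerSeries_mul hlam ν x p.2).const_mul _

lemma coeff_mul_prod_gegenbauerSeries_eq_integral (hlam : ∀ i, -(1 / 2 : ℝ) < lam i)
    (F : PowerSeries ℝ) (x : Fin (k + 1) → ℝ) (n : ℕ) :
    coeff n (F * ∏ i, gegenbauerSeries (lam i + 1) (x i)) =
      sigmaConst (fun i => lam i + 1) *
        ∫ y, coeff n (F * gegenbauerSeries (∑ i, (lam i + 1)) (∑ i, x i * y i)) *
          ∏ i, y i ^ lam i ∂simplexMeasure (k + 1) := by
  rw [coeff_mul_gegenbauerSeries_mul, integral_finsetSum, PowerSeries.coeff_mul, Finset.mul_sum]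
  · refine Finset.sum_congr rfl fun p _ => ?_
    rw [integral_const_mul, coeff_prod_gegenbauerSeries_eq_integral hlam]
    ring
  · exact fun p _ => (integrable_coeff_gegenbauerSeries_mul hlam _ x p.2).const_mul _

lemma neg_half_lt_sum_add (hlam : ∀ i, -(1 / 2 : ℝ) < lam i) :
    -(1 / 2 : ℝ) < (∑ i, lam i) + (k + 1 : ℕ) - 1 := by
  have h : 0 < ∑ i, (lam i + 1 / 2) :=
    Finset.sum_pos (fun i _ => by linarith [hlam i]) Finset.univ_nonempty
  simp only [Finset.sum_add_distrib, Finset.sum_const, Finset.card_univ, Fintype.card_fin,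
    nsmul_eq_mul] at h
  push_cast at h ⊢
  have : (0 : ℝ) ≤ k := Nat.cast_nonneg k
  linarith

lemma gegenbauerCesaroKernel_one_right {Λ : ℝ} (h : -(1 / 2) < Λ) (δ : ℝ) (n : ℕ) (s : ℝ) :
    gegenbauerCesaroKernel Λ δ n s 1 = 1 / Ring.choose ((n : ℝ) + δ) n *
      coeff n (negBinomial ℝ (δ + 1) * (1 - X ^ 2) * gegenbauerSeries (Λ + 1) s) := by
  rw [gegenbauerCesaroKernel_eq h, zonalKernelSeries_one_right h, mul_assoc]

lemma integrable_gegenbauerCesaroKernel_mul (hlam : ∀ i, -(1 / 2 : ℝ) < lam i) {Λ : ℝ}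
    (h : -(1 / 2) < Λ) (δ : ℝ) (n : ℕ) (x : Fin (k + 1) → ℝ) :
    Integrable (fun y : Fin (k + 1) → ℝ =>
      gegenbauerCesaroKernel Λ δ n (∑ i, x i * y i) 1 * ∏ i, y i ^ lam i)
      (simplexMeasure (k + 1)) := by
  simp_rw [gegenbauerCesaroKernel_one_right h, mul_assoc (1 / Ring.choose ((n : ℝ) + δ) n)]
  exact (integrable_coeff_mul_gegenbauerSeries_mul hlam _ _ x n).const_mul _

/-- The Cesàro kernel at the corner `(1, …, 1)` as a combination of Dirichlet averages of Cesàro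
kernels in one variable. The factor `(1 + X) ^ k` left over from
`(1 - X) ^ (-(δ + 1 + k)) (1 - X ^ 2) ^ (k + 1)` produces the sum over `m`. -/
theorem cesaroKernel_one_right (hlam : ∀ i, -(1 / 2 : ℝ) < lam i) {δ : ℝ} (hδ : -1 < δ) (n : ℕ)
    (x : Fin (k + 1) → ℝ) :
    cesaroKernel (cube (k + 1)) (productWeight lam) (δ + k) n x (fun _ => 1) =
      1 / Ring.choose ((n : ℝ) + (δ + k)) n *
        ∑ m ∈ Finset.range (min n k + 1),
          (k.choose m : ℝ) * Ring.choose (((n - m : ℕ) : ℝ) + δ) (n - m) *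
            (sigmaConst (fun i => lam i + 1) *
              ∫ y, gegenbauerCesaroKernel ((∑ i, lam i) + (k + 1 : ℕ) - 1) δ (n - m)
                (∑ i, x i * y i) 1 * ∏ i, y i ^ lam i ∂(simplexMeasure (k + 1))) := by
  have hΛ := neg_half_lt_sum_add hlam
  have hsum : (∑ i, lam i) + (k + 1 : ℕ) - 1 + 1 = ∑ i, (lam i + 1) := by
    simp [Finset.sum_add_distrib]
  have hseries : negBinomial ℝ (δ + k + 1) * ∏ i, zonalKernelSeries (lam i) (x i) 1 =
      (1 + X) ^ k * (negBinomial ℝ (δ + 1) * (1 - X ^ 2) *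
        ∏ i, gegenbauerSeries (lam i + 1) (x i)) := by
    rw [Finset.prod_congr rfl fun i _ => zonalKernelSeries_one_right (hlam i) (x i),
      Finset.prod_mul_distrib, Finset.prod_const, Finset.card_univ, Fintype.card_fin,
      show δ + k + 1 = (δ + 1) + k by ring, PowerSeries.negBinomial_add]
    have h1 : negBinomial ℝ (k : ℝ) * (1 - X) ^ k = 1 := by
      rw [← PowerSeries.negBinomial_neg_natCast, ← PowerSeries.negBinomial_add, add_neg_cancel,
        PowerSeries.negBinomial_zero]
    have h2 : (1 - X ^ 2 : PowerSeries ℝ) ^ (k + 1) =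
        (1 - X) ^ k * (1 + X) ^ k * (1 - X ^ 2) := by
      rw [pow_succ, ← mul_pow]; ring
    rw [h2]
    linear_combination (negBinomial ℝ (δ + 1) * (1 + X) ^ k * (1 - X ^ 2) *
      ∏ i, gegenbauerSeries (lam i + 1) (x i)) * h1
  rw [cesaroKernel_eq hlam, hseries, PowerSeries.coeff_one_add_X_pow_mul]
  congr 1
  refine Finset.sum_congr rfl fun m _ => ?_
  have hc := (choose_add_pos hδ (n - m)).ne'
  simp_rw [gegenbauerCesaroKernel_one_right hΛ, hsum,
    mul_assoc (1 / Ring.choose (((n - m : ℕ) : ℝ) + δ) (n - m))]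
  rw [integral_const_mul, coeff_mul_prod_gegenbauerSeries_eq_integral hlam]
  field_simp

lemma sigmaConst_nonneg (hlam : ∀ i, -(1 / 2 : ℝ) < lam i) :
    0 ≤ sigmaConst (fun i => lam i + 1) := by
  have h : ∀ i, 0 < lam i + 1 := fun i => by linarith [hlam i]
  exact div_nonneg
    (Real.Gamma_pos_of_pos (Finset.sum_pos (fun i _ => h i) Finset.univ_nonempty)).le
    (Finset.prod_nonneg fun i _ => (Real.Gamma_pos_of_pos (h i)).le)

end

/-! ### Positivity -/

lemma gegenbauerCesaroKernel_one_right_nonneg {Λ δ s : ℝ} (hΛ : 0 ≤ Λ) (hδ : 2 * Λ + 1 ≤ δ)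
    (hs : |s| ≤ 1) (n : ℕ) : 0 ≤ gegenbauerCesaroKernel Λ δ n s 1 := by
  rw [gegenbauerCesaroKernel_one_right (by linarith)]
  refine mul_nonneg (one_div_nonneg.2 (choose_add_pos (by linarith) n).le) ?_
  rw [show δ + 1 = (δ - (2 * Λ + 1)) + (2 * Λ + 2) by ring, PowerSeries.negBinomial_add, mul_assoc,
    mul_assoc]
  exact (PowerSeries.coeffNonneg_negBinomial (by linarith)).mul
    (PowerSeries.coeffNonneg_kogbetliantz hΛ hs) n

lemma abs_sum_mul_le_one {ι : Type*} [Fintype ι] {x y : ι → ℝ} (hx : ∀ i, |x i| ≤ 1)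
    (hy : ∀ i, 0 ≤ y i) (hy1 : ∑ i, y i = 1) : |∑ i, x i * y i| ≤ 1 := by
  refine (Finset.abs_sum_le_sum_abs _ _).trans ?_
  rw [← hy1]
  refine Finset.sum_le_sum fun i _ => ?_
  rw [abs_mul, abs_of_nonneg (hy i)]
  exact mul_le_of_le_one_left (hy i) (hx i)

/-- For nonnegative indices positivity reduces to one variable, since
`(1 - X) ^ (-2 (|lam| + d))` is the product of the factors `(1 - X) ^ (-2 (lam_i + 1))`. -/
lemma cesaroKernel_nonneg {d : ℕ} {lam : Fin d → ℝ} (hlam : ∀ i, 0 ≤ lam i) {δ : ℝ}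
    (hδ : 2 * ((∑ i, lam i) + d) - 1 ≤ δ) (hδ1 : -1 < δ) (n : ℕ) {x y : Fin d → ℝ}
    (hx : x ∈ cube d) (hy : y ∈ cube d) :
    0 ≤ cesaroKernel (cube d) (productWeight lam) δ n x y := by
  rw [cesaroKernel_eq fun i => by linarith [hlam i]]
  refine mul_nonneg (one_div_nonneg.2 (choose_add_pos hδ1 n).le) ?_
  have hprod : negBinomial ℝ (2 * ((∑ i, lam i) + d)) = ∏ i, negBinomial ℝ (2 * lam i + 2) := by
    have h : ∀ s : Finset (Fin d), negBinomial ℝ (∑ i ∈ s, (2 * lam i + 2)) =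
        ∏ i ∈ s, negBinomial ℝ (2 * lam i + 2) := fun s => by
      induction s using Finset.cons_induction with
      | empty => simp
      | cons a s ha ih =>
        rw [Finset.sum_cons, Finset.prod_cons, PowerSeries.negBinomial_add, ih]
    rw [← h, Finset.sum_add_distrib, ← Finset.mul_sum]
    simp only [Finset.sum_const, Finset.card_univ, Fintype.card_fin, nsmul_eq_mul]
    ring_nf
  rw [show δ + 1 = (δ - (2 * ((∑ i, lam i) + d) - 1)) + 2 * ((∑ i, lam i) + d) by ring,
    PowerSeries.negBinomial_add, hprod, mul_assoc, ← Finset.prod_mul_distrib]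
  exact (PowerSeries.coeffNonneg_negBinomial (by linarith)).mul (CoeffNonneg.prod _
    fun i _ => coeffNonneg_zonalKernelSeries (hlam i) (hx i) (hy i)) n

end ProductGegenbauer

theorem proposition3p2 (d : ℕ) (hd : 1 ≤ d) (lam : Fin d → ℝ) (hlam : ∀ i, -(1 / 2 : ℝ) < lam i) :
    (∀ δ : ℝ, -1 < δ → ∀ (n : ℕ), ∀ x ∈ cube d,
      (∀ m ∈ Finset.range (min n (d - 1) + 1),
        MeasureTheory.Integrable (fun y : Fin d → ℝ =>
          gegenbauerCesaroKernel ((∑ i, lam i) + d - 1) δ (n - m) (∑ i, x i * y i) 1 *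
            ∏ i, y i ^ lam i) (simplexMeasure d)) ∧
      cesaroKernel (cube d) (productWeight lam) (δ + d - 1) n x (fun _ => 1) =
        1 / Ring.choose ((n : ℝ) + δ + d - 1) n *
          ∑ m ∈ Finset.range (min n (d - 1) + 1),
            ((d - 1).choose m : ℝ) * Ring.choose (((n - m : ℕ) : ℝ) + δ) (n - m) *
              (sigmaConst (fun i => lam i + 1) *
                ∫ y, gegenbauerCesaroKernel ((∑ i, lam i) + d - 1) δ (n - m) (∑ i, x i * y i) 1 *
                  ∏ i, y i ^ lam i ∂(simplexMeasure d))) ∧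
    ((∀ i, 0 ≤ lam i) → ∀ δ : ℝ, 2 * ((∑ i, lam i) + d) - 1 ≤ δ →
      ∀ (n : ℕ), ∀ x ∈ cube d, ∀ y ∈ cube d,
        0 ≤ cesaroKernel (cube d) (productWeight lam) δ n x y) ∧
    (0 ≤ (∑ i, lam i) + d - 1 → ∀ δ : ℝ, 2 * ((∑ i, lam i) + d) - 1 ≤ δ →
      ∀ (n : ℕ), ∀ x ∈ cube d,
        0 ≤ cesaroKernel (cube d) (productWeight lam) (δ + d - 1) n x (fun _ => 1)) := by
  obtain ⟨k, rfl⟩ := Nat.exists_eq_add_of_le' hd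
  have hk : ∀ δ : ℝ, δ + (k + 1 : ℕ) - 1 = δ + k := fun δ => by push_cast; ring
  refine ⟨fun δ hδ n x _ => ⟨fun m _ => ?_, ?_⟩, fun h0 δ hδ n x hx y hy => ?_,
    fun hΛ δ hδ n x hx => ?_⟩
  · exact integrable_gegenbauerCesaroKernel_mul hlam (neg_half_lt_sum_add hlam) δ (n - m) x
  · rw [hk, hk, add_assoc, Nat.add_sub_cancel]
    exact cesaroKernel_one_right hlam hδ n x
  · have h1 : (0 : ℝ) ≤ ∑ i, lam i := Finset.sum_nonneg fun i _ => h0 i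
    have h2 : (0 : ℝ) ≤ (k + 1 : ℕ) := Nat.cast_nonneg _
    exact cesaroKernel_nonneg h0 hδ (by
      push_cast at hδ
      have : (0 : ℝ) ≤ k := Nat.cast_nonneg k
      linarith) n hx hy
  · have hδ1 : -1 < δ := by linarith
    have hδk : -1 < δ + k := by
      have : (0 : ℝ) ≤ k := Nat.cast_nonneg k
      linarith
    rw [hk, cesaroKernel_one_right hlam hδ1]
    refine mul_nonneg (one_div_nonneg.2 (choose_add_pos hδk n).le)
      (Finset.sum_nonneg fun m _ => mul_nonneg
        (mul_nonneg (Nat.cast_nonneg _) (choose_add_pos hδ1 _).le)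
        (mul_nonneg (sigmaConst_nonneg hlam) (integral_nonneg_of_ae ?_)))
    filter_upwards [ae_simplexMeasure k] with y hy
    exact mul_nonneg (gegenbauerCesaroKernel_one_right_nonneg hΛ (by linarith)
      (abs_sum_mul_le_one (fun i => abs_le.2 (hx i)) hy.1 hy.2) _)
      (Finset.prod_nonneg fun i _ => Real.rpow_nonneg (hy.1 i) _)
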